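/- Let $d\ge 1$ be an integer. Write $|\cdot|$ for Lebesgue measure on $\mathbb R^d$. We use the following definitions. **Bounded variation.** For $u\in L^1(\mathbb R^d)$ let $\|Du\|=\sup\{\int u\,\mathrm{div}\,v : v\in C^1_c(\mathbb R^d;\mathbb R^d),\ |v|\le 1\}$. The space $BV([0,1]^d)$ consists of the (classes of) $u\in L^1(\mathbb R^d)$ that vanish a.e. outside $[0,1]^d$ and satisfy $\|Du\|<\infty$. Its norm is $\|u\|_{BV}=\|u\|_1+\|Du\|$. Let $\mathcal{BV}([0,1]^d)$ be the collection of Lebesgue measurable sets $B\subset[0,1]^d$ with finite perimeter $\|B\|=\|D\mathbf 1_B\|$. **Charges.** A *charge* on $[0,1]^d$ is a function $\mu:\mathcal{BV}([0,1]^d)\to\mathbb R$ with the following two properties. It is finitely additive: $\mu(B_1\cup B_2)=\mu(B_1)+\mu(B_2)$ if $|B_1\cap B_2|=0$. It is continuous: $\mu(B_n)\to\mu(B)$ whenever $B_n, B\in\mathcal{BV}([0,1]^d)$, $\sup_n\|B_n\|<\infty$ and $|B_n\triangle B|\to 0$. Let $SCH([0,1]^d)$ be the closure, in the dual Banach space $BV([0,1]^d)^*$,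 of the set of functionals $u\mapsto\int_{[0,1]^d} g\,u$ with $g\in L^d([0,1]^d)$. A charge $\mu$ is *strong* if there is $\alpha\in SCH([0,1]^d)$ with $\mu(B)=\alpha(\mathbf 1_B)$ for all $B\in\mathcal{BV}([0,1]^d)$. **Increments.** Let $C_0([0,1]^d)$ be the set of continuous $f:[0,1]^d\to\mathbb R$ with $f(x)=0$ whenever some coordinate $x_i$ is $0$. For a rectangle $K=\prod_i[a_i,b_i]\subset[0,1]^d$ (with $a_i<b_i$) put $$\Delta_f(K)=\sum_{c\in\prod_i\{a_i,b_i\}}(-1)^{\#\{i\,:\,c_i=a_i\}}f(c).$$ Extend $\Delta_f$ additively to figures, that is, finite unions of rectangles contained in $[0,1]^d$: $\Delta_f\big(\bigcup_j K_j\big)=\sum_j\Delta_f(K_j)$ for finitely many rectangles $K_j$ that are pairwise almost disjoint, i.e. $|K_j\cap K_l|=0$ for $j\ne l$. **Hölder strong chargeability.** A *dyadic cube* is a set $\prod_i[2^{-n}k_i,2^{-n}(k_i+1)]$ with $n\ge 0$ and integers $0\le k_i\le 2^n-1$. For $\frac{d-1}{d}<\gamma<1$, $f\in C_0([0,1]^d)$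 is *$\gamma$-Hölder strongly chargeable* if $\Delta_f$ extends from figures to a strong charge $\mu$ on $[0,1]^d$ for which there is a constant $C'\ge 0$ with $|\mu(K)|\le C'|K|^\gamma$ for all dyadic cubes $K$. **Proposition.** Let $f\in C_0([0,1]^d)$ and $\frac{d-1}{d}<\gamma<1$. Suppose that there is a constant $C\ge 0$ such that $|\Delta_f(K)|\le C|K|^\gamma$ for all dyadic cubes $K$. Then $f$ is $\gamma$-Hölder strongly chargeable. -/

import Mathlib

open MeasureTheory Filter Topology
open scoped ENNReal

noncomputable section

namespace StrongCharge

/-- The ambient space `ℝ^d` with its Euclidean norm. -/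
abbrev E (d : ℕ) : Type := EuclideanSpace ℝ (Fin d)

/-- The closed box `∏ [a i, b i]`. -/
def box {d : ℕ} (a b : Fin d → ℝ) : Set (E d) := {x | ∀ i, a i ≤ x i ∧ x i ≤ b i}

/-- The unit cube `[0,1]^d`. -/
def unitCube (d : ℕ) : Set (E d) := box (fun _ => 0) (fun _ => 1)

/-! ### Functions of bounded variation -/

/-- The divergence of a vector field. -/
def divergence {d : ℕ} (v : E d → E d) (x : E d) : ℝ :=
  ∑ i, (fderiv ℝ v x (EuclideanSpace.single i 1)) i

/-- Compactly supported `C¹` vector fields of Euclidean norm at most `1`. -/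
def IsTestField {d : ℕ} (v : E d → E d) : Prop :=
  ContDiff ℝ 1 v ∧ HasCompactSupport v ∧ ∀ x, ‖v x‖ ≤ 1

/-- The variation `‖Du‖(ℝ^d)` of an integrable function `u`. (The supremum is nonnegative because
the zero field is a test field, so truncating at `0` does not change it.) -/
def variation {d : ℕ} (u : E d → ℝ) : ℝ≥0∞ :=
  ⨆ (v : E d → E d) (_ : IsTestField v), ENNReal.ofReal (∫ x, u x * divergence v x)

theorem variation_congr {d : ℕ} {u w : E d → ℝ} (h : u =ᵐ[volume] w) :
    variation u = variation w := by
  unfold variation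
  refine iSup_congr fun v => iSup_congr fun _ => ?_
  congr 1
  refine integral_congr_ae ?_
  filter_upwards [h] with x hx
  rw [hx]

theorem IsTestField.neg {d : ℕ} {v : E d → E d} (hv : IsTestField v) :
    IsTestField (fun x => -v x) :=
  ⟨hv.1.neg, hv.2.1.neg, fun x => by rw [norm_neg]; exact hv.2.2 x⟩

theorem divergence_neg {d : ℕ} (v : E d → E d) (x : E d) :
    divergence (fun y => -v y) x = -divergence v x := by
  simp [divergence, fderiv_fun_neg]

theorem IsTestField.integrable_mul {d : ℕ} {v : E d → E d} (hv : IsTestField v)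
    {u : E d → ℝ} (hu : Integrable u volume) :
    Integrable (fun x => u x * divergence v x) volume := by
  have hcf : Continuous (fderiv ℝ v) := hv.1.continuous_fderiv one_ne_zero
  have hc : Continuous (divergence v) := by
    unfold divergence
    fun_prop
  have hs : HasCompactSupport (divergence v) := by
    refine (hv.2.1.fderiv ℝ).mono fun x hx => ?_
    simp only [Function.mem_support] at hx ⊢
    intro h
    exact hx (by simp [divergence, h])
  obtain ⟨M, hM⟩ := hc.bounded_above_of_compact_support hs
  exact hu.mul_bdd hc.aestronglyMeasurable (Eventually.of_forall hM)

theorem variation_add_le {d : ℕ} {u w : E d → ℝ} (hu : Integrable u volume)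
    (hw : Integrable w volume) : variation (u + w) ≤ variation u + variation w := by
  refine iSup₂_le fun v hv => ?_
  have : ∫ x, (u + w) x * divergence v x
      = (∫ x, u x * divergence v x) + ∫ x, w x * divergence v x := by
    rw [← integral_add (hv.integrable_mul hu) (hv.integrable_mul hw)]
    congr 1
    funext x
    simp [add_mul]
  rw [this]
  refine ENNReal.ofReal_add_le.trans (add_le_add ?_ ?_)
  · exact le_iSup₂ (f := fun (v : E d → E d) (_ : IsTestField v) =>
      ENNReal.ofReal (∫ x, u x * divergence v x)) v hv
  · exact le_iSup₂ (f := fun (v : E d → E d) (_ : IsTestField v) =>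
      ENNReal.ofReal (∫ x, w x * divergence v x)) v hv

theorem variation_smul_le {d : ℕ} (c : ℝ) (u : E d → ℝ) :
    variation (c • u) ≤ ENNReal.ofReal |c| * variation u := by
  refine iSup₂_le fun v hv => ?_
  have h1 : ∫ x, (c • u) x * divergence v x = c * ∫ x, u x * divergence v x := by
    rw [← integral_const_mul]
    congr 1
    funext x
    simp [mul_assoc]
  rw [h1]
  rcases le_total 0 c with hc | hc
  · rw [abs_of_nonneg hc, ENNReal.ofReal_mul hc]
    gcongr
    exact le_iSup₂ (f := fun (v : E d → E d) (_ : IsTestField v) =>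
      ENNReal.ofReal (∫ x, u x * divergence v x)) v hv
  · have h2 : c * ∫ x, u x * divergence v x
        = (-c) * ∫ x, u x * divergence (fun y => -v y) x := by
      simp only [divergence_neg, mul_neg, integral_neg]
      ring
    rw [h2, abs_of_nonpos hc, ENNReal.ofReal_mul (neg_nonneg.2 hc)]
    gcongr
    exact le_iSup₂ (f := fun (v : E d → E d) (_ : IsTestField v) =>
      ENNReal.ofReal (∫ x, u x * divergence v x)) _ hv.neg

theorem variation_zero {d : ℕ} : variation (0 : E d → ℝ) = 0 := by
  simp [variation]

/-- The integrable functions on `ℝ^d` (modulo equality almost everywhere) that vanish almost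
everywhere outside `[0,1]^d` and have finite variation on `ℝ^d`, as a linear subspace of `L¹`. -/
def bvSubmodule (d : ℕ) : Submodule ℝ (Lp ℝ 1 (volume : Measure (E d))) where
  carrier := {u | (∀ᵐ x, x ∉ unitCube d → u x = 0) ∧ variation (u : E d → ℝ) < ⊤}
  zero_mem' := by
    refine ⟨?_, ?_⟩
    · filter_upwards [Lp.coeFn_zero ℝ 1 (volume : Measure (E d))] with x hx _
      exact hx
    · rw [variation_congr (Lp.coeFn_zero ℝ 1 (volume : Measure (E d))), variation_zero]
      exact ENNReal.zero_lt_top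
  add_mem' := by
    rintro u w ⟨hu, hu'⟩ ⟨hw, hw'⟩
    refine ⟨?_, ?_⟩
    · filter_upwards [Lp.coeFn_add u w, hu, hw] with x hx h1 h2 hxc
      rw [hx, Pi.add_apply, h1 hxc, h2 hxc, add_zero]
    · rw [variation_congr (Lp.coeFn_add u w)]
      exact (variation_add_le (L1.integrable_coeFn u) (L1.integrable_coeFn w)).trans_lt
        (ENNReal.add_lt_top.2 ⟨hu', hw'⟩)
  smul_mem' := by
    rintro c u ⟨hu, hu'⟩
    refine ⟨?_, ?_⟩
    · filter_upwards [Lp.coeFn_smul c u, hu] with x hx h1 hxc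
      rw [hx, Pi.smul_apply, h1 hxc, smul_zero]
    · rw [variation_congr (Lp.coeFn_smul c u)]
      exact (variation_smul_le c u).trans_lt (ENNReal.mul_lt_top ENNReal.ofReal_lt_top hu')

/-- The space `BV([0,1]^d)`. It is a type of its own because it carries the `BV` norm and not the
norm of `L¹`. -/
def BV (d : ℕ) : Type := bvSubmodule d

namespace BV

instance (d : ℕ) : AddCommGroup (BV d) := inferInstanceAs (AddCommGroup (bvSubmodule d))

instance (d : ℕ) : Module ℝ (BV d) := inferInstanceAs (Module ℝ (bvSubmodule d))

/-- The underlying element of `L¹`. -/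
def toL1 {d : ℕ} : BV d →ₗ[ℝ] Lp ℝ 1 (volume : Measure (E d)) := (bvSubmodule d).subtype

theorem toL1_injective {d : ℕ} : Function.Injective (toL1 (d := d)) :=
  Submodule.subtype_injective (bvSubmodule d)

theorem variation_lt_top {d : ℕ} (u : BV d) : variation (toL1 u : E d → ℝ) < ⊤ :=
  (show bvSubmodule d from u).2.2

/-- The norm `‖u‖_BV = ‖u‖₁ + ‖Du‖(ℝ^d)`. -/
def bvNorm {d : ℕ} (u : BV d) : ℝ := ‖toL1 u‖ + (variation (toL1 u : E d → ℝ)).toReal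

theorem bvNorm_smul_le {d : ℕ} (c : ℝ) (u : BV d) : bvNorm (c • u) ≤ ‖c‖ * bvNorm u := by
  rw [bvNorm, bvNorm, mul_add, map_smul, norm_smul]
  refine add_le_add le_rfl ?_
  rw [variation_congr (Lp.coeFn_smul c (toL1 u))]
  have h := ENNReal.toReal_mono
    (ENNReal.mul_lt_top ENNReal.ofReal_lt_top (variation_lt_top u)).ne
    (variation_smul_le c (toL1 u : E d → ℝ))
  rwa [ENNReal.toReal_mul, ENNReal.toReal_ofReal (abs_nonneg c)] at h

/-- The `BV` norm as a group norm. -/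
def groupNorm (d : ℕ) : AddGroupNorm (BV d) where
  toFun := bvNorm
  map_zero' := by
    rw [bvNorm, map_zero, variation_congr (Lp.coeFn_zero ℝ 1 (volume : Measure (E d))),
      variation_zero]
    simp
  add_le' u w := by
    rw [bvNorm, bvNorm, bvNorm, map_add,
      variation_congr (Lp.coeFn_add (toL1 u) (toL1 w))]
    have h1 := norm_add_le (toL1 u) (toL1 w)
    have h2 := ENNReal.toReal_mono
      (ENNReal.add_lt_top.2 ⟨variation_lt_top u, variation_lt_top w⟩).ne
      (variation_add_le (L1.integrable_coeFn (toL1 u)) (L1.integrable_coeFn (toL1 w)))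
    rw [ENNReal.toReal_add (variation_lt_top u).ne (variation_lt_top w).ne] at h2
    linarith
  neg' u := by
    have h1 := bvNorm_smul_le (-1) u
    have h2 := bvNorm_smul_le (-1) (-u)
    simp only [neg_smul, one_smul, neg_neg, norm_neg, norm_one, one_mul] at h1 h2
    exact le_antisymm h1 h2
  eq_zero_of_map_eq_zero' u hu := by
    rw [bvNorm] at hu
    have h1 : ‖toL1 u‖ = 0 :=
      le_antisymm (by linarith [ENNReal.toReal_nonneg (a := variation (toL1 u : E d → ℝ))])
        (norm_nonneg _)
    exact toL1_injective ((norm_eq_zero.1 h1).trans (map_zero toL1).symm)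

instance (d : ℕ) : NormedAddCommGroup (BV d) := (groupNorm d).toNormedAddCommGroup

theorem norm_def {d : ℕ} (u : BV d) :
    ‖u‖ = ‖toL1 u‖ + (variation (toL1 u : E d → ℝ)).toReal := rfl

instance (d : ℕ) : NormedSpace ℝ (BV d) where
  norm_smul_le := bvNorm_smul_le

end BV

/-! ### `BV`-sets and charges -/

/-- The perimeter `‖A‖ = ‖D 1_A‖(ℝ^d)`. -/
def perimeter {d : ℕ} (A : Set (E d)) : ℝ≥0∞ := variation (A.indicator (fun _ => (1 : ℝ)))

/-- `B` belongs to `𝓑𝓥([0,1]^d)`: it is a (Lebesgue) measurable subset of `[0,1]^d` of finite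
perimeter. -/
structure IsBVSet {d : ℕ} (B : Set (E d)) : Prop where
  subset : B ⊆ unitCube d
  measurable : NullMeasurableSet B volume
  perimeter_lt_top : perimeter B < ⊤

/-- Charges on `[0,1]^d`. Only the values of `μ` on `𝓑𝓥([0,1]^d)` matter. -/
structure IsCharge {d : ℕ} (μ : Set (E d) → ℝ) : Prop where
  /-- finite additivity -/
  additive : ∀ B₁ B₂ : Set (E d), IsBVSet B₁ → IsBVSet B₂ → volume (B₁ ∩ B₂) = 0 →
    μ (B₁ ∪ B₂) = μ B₁ + μ B₂
  /-- continuity with respect to `BV`-convergence -/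
  continuous : ∀ (B : ℕ → Set (E d)) (B' : Set (E d)), (∀ n, IsBVSet (B n)) → IsBVSet B' →
    ⨆ n, perimeter (B n) < ⊤ →
    Tendsto (fun n => volume (symmDiff (B n) B')) atTop (𝓝 0) →
    Tendsto (fun n => μ (B n)) atTop (𝓝 (μ B'))

theorem volume_unitCube_lt_top (d : ℕ) : volume (unitCube d) < ⊤ := by
  have hb : Bornology.IsBounded (unitCube d) := by
    refine (Metric.isBounded_closedBall (x := (0 : E d)) (r := d)).subset fun x hx => ?_
    rw [mem_closedBall_zero_iff]
    refine (EuclideanSpace.norm_eq x).trans_le ?_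
    rw [Real.sqrt_le_left (Nat.cast_nonneg d)]
    calc ∑ i, ‖x i‖ ^ 2 ≤ ∑ _i : Fin d, (1 : ℝ) := by
          refine Finset.sum_le_sum fun i _ => ?_
          rw [Real.norm_eq_abs, sq_abs]
          have := hx i
          nlinarith [this.1, this.2]
      _ = d := by simp
      _ ≤ (d : ℝ) ^ 2 := by
          exact_mod_cast Nat.le_self_pow two_ne_zero d
  exact hb.measure_lt_top

theorem IsBVSet.memLp {d : ℕ} {B : Set (E d)} (hB : IsBVSet B) :
    MemLp (B.indicator (fun _ => (1 : ℝ))) 1 volume := by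
  rw [memLp_one_iff_integrable]
  refine IntegrableOn.integrable_indicator₀ (integrableOn_const ?_) hB.measurable
  exact ((measure_mono hB.subset).trans_lt (volume_unitCube_lt_top d)).ne

/-- The indicator function `1_B` of a `BV`-set as an element of `BV([0,1]^d)`. -/
def IsBVSet.indicator {d : ℕ} {B : Set (E d)} (hB : IsBVSet B) : BV d :=
  (⟨hB.memLp.toLp _, by
    refine ⟨?_, ?_⟩
    · filter_upwards [hB.memLp.coeFn_toLp] with x hx hxc
      rw [hx, Set.indicator_of_notMem (fun h => hxc (hB.subset h))]
    · rw [variation_congr hB.memLp.coeFn_toLp]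
      exact hB.perimeter_lt_top⟩ : bvSubmodule d)

/-! ### Strong charges -/

/-- The range of `T : L^d([0,1]^d) → BV([0,1]^d)^*`, `T_g(u) = ∫_{[0,1]^d} g u`. -/
def rangeT (d : ℕ) : Set (StrongDual ℝ (BV d)) :=
  {φ | ∃ g : E d → ℝ, MemLp g (d : ℝ≥0∞) (volume.restrict (unitCube d)) ∧
    ∀ u : BV d, φ u = ∫ x in unitCube d, g x * BV.toL1 u x}

/-- The space `SCH([0,1]^d)` of strong charge functionals: the closure, for the dual norm, of the
range of `T`. -/
def SCH (d : ℕ) : Set (StrongDual ℝ (BV d)) := closure (rangeT d)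

/-- Strong charges: the charges `B ↦ α(1_B)` where `α` is a strong charge functional. -/
def IsStrongCharge {d : ℕ} (μ : Set (E d) → ℝ) : Prop :=
  IsCharge μ ∧ ∃ α ∈ SCH d, ∀ (B : Set (E d)) (hB : IsBVSet B), μ B = α hB.indicator

/-! ### Increments and strong chargeability -/

/-- `f` belongs to `C_0([0,1]^d)`. Only the values of `f` on `[0,1]^d` matter. -/
def MemC0 {d : ℕ} (f : E d → ℝ) : Prop :=
  ContinuousOn f (unitCube d) ∧ ∀ x ∈ unitCube d, (∃ i, x i = 0) → f x = 0

/-- The increment `Δ_f(∏ [a i, b i])` over a rectangle: the sum over its corners `c`, with the sign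
`-1` for each coordinate at which `c i = a i`. Here `s` is the set of these coordinates. -/
def increment {d : ℕ} (f : E d → ℝ) (a b : Fin d → ℝ) : ℝ :=
  ∑ s : Finset (Fin d), (-1 : ℝ) ^ s.card *
    f (WithLp.toLp 2 (fun i => if i ∈ s then a i else b i))

/-- `box a b` is a rectangle (with non-empty interior) contained in `[0,1]^d`. -/
def IsRectangle {d : ℕ} (a b : Fin d → ℝ) : Prop := ∀ i, 0 ≤ a i ∧ a i < b i ∧ b i ≤ 1

/-- On figures, `μ` is equal to `Δ_f`. A figure is a finite union of rectangles, which may be taken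
pairwise almost disjoint, and the additive function `Δ_f` takes on it the sum of the increments
of `f` over these rectangles. -/
def ExtendsIncrement {d : ℕ} (f : E d → ℝ) (μ : Set (E d) → ℝ) : Prop :=
  ∀ (m : ℕ) (a b : Fin m → Fin d → ℝ), (∀ j, IsRectangle (a j) (b j)) →
    (∀ j k, j ≠ k → volume (box (a j) (b j) ∩ box (a k) (b k)) = 0) →
    μ (⋃ j, box (a j) (b j)) = ∑ j, increment f (a j) (b j)

/-- `f` is strongly chargeable, and `μ` is the strong charge that extends `Δ_f`. -/
def IsStrongChargeOf {d : ℕ} (f : E d → ℝ) (μ : Set (E d) → ℝ) : Prop :=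
  IsStrongCharge μ ∧ ExtendsIncrement f μ

/-- Lower corner of the dyadic cube `∏ [2^{-n} k i, 2^{-n} (k i + 1)]`. -/
def dyadicLower {d : ℕ} (n : ℕ) (k : Fin d → Fin (2 ^ n)) : Fin d → ℝ :=
  fun i => ((k i : ℕ) : ℝ) / 2 ^ n

/-- Upper corner of the dyadic cube `∏ [2^{-n} k i, 2^{-n} (k i + 1)]`. -/
def dyadicUpper {d : ℕ} (n : ℕ) (k : Fin d → Fin (2 ^ n)) : Fin d → ℝ :=
  fun i => (((k i : ℕ) : ℝ) + 1) / 2 ^ n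

/-- The dyadic cube `∏ [2^{-n} k i, 2^{-n} (k i + 1)]`, where `0 ≤ k i ≤ 2^n - 1`. -/
def dyadicCube {d : ℕ} (n : ℕ) (k : Fin d → Fin (2 ^ n)) : Set (E d) :=
  box (dyadicLower n k) (dyadicUpper n k)

/-- `μ` is `γ`-Hölder: `|μ(K)| ≤ C |K|^γ` for all dyadic cubes `K`. -/
def IsHolder {d : ℕ} (γ : ℝ) (μ : Set (E d) → ℝ) : Prop :=
  ∃ C : ℝ, 0 ≤ C ∧ ∀ (n : ℕ) (k : Fin d → Fin (2 ^ n)),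
    |μ (dyadicCube n k)| ≤ C * (volume.real (dyadicCube n k)) ^ γ

/-- `f` is `γ`-Hölder strongly chargeable: `Δ_f` extends to a strong charge that is `γ`-Hölder. -/
def IsHolderStronglyChargeable {d : ℕ} (γ : ℝ) (f : E d → ℝ) : Prop :=
  ∃ μ : Set (E d) → ℝ, IsStrongChargeOf f μ ∧ IsHolder γ μ

end StrongCharge

end

/-!
Let `g_n` be the step function which on each dyadic cube of side `2^{-n}` is constant with integral
the increment of `f` over that cube. The averages of `g_{n+1}` over the dyadic cubes of side
`2^{-n}` are the values of `g_n`, so `∫ u (g_{n+1} - g_n)` compares `u` with its translates by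
vectors of size at most a multiple of `2^{-n}`. As `‖u(· + z) - u‖₁ ≤ |z| ‖Du‖`, the functionals
`φ_n u = ∫ g_n u` satisfy `‖φ_{n+1} - φ_n‖ ≤ 2^d d 2^{-n} sup |g_{n+1}|`, which is a multiple of
`2^{n (d (1 - γ) - 1)}`; this is summable exactly when `γ > (d - 1) / d`. The limit of `φ_n` is a
strong charge functional. On rectangles with dyadic corners it takes the value of the increment
because `φ_m` does for all large `m`, and on all rectangles by continuity of charges and of `f`.
-/

namespace StrongCharge

/-! ### The `L¹` modulus of continuity of a function of bounded variation -/

section TestFunctions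

open ContinuousLinearMap
open scoped Convolution

variable {V : Type*} [NormedAddCommGroup V] [NormedSpace ℝ V] [FiniteDimensional ℝ V]
  [MeasurableSpace V] [BorelSpace V] {μ : Measure V} [μ.IsAddHaarMeasure] {w g : V → ℝ} {M : ℝ}

theorem abs_convolution_normed_le (φ : ContDiffBump (0 : V)) {S : ℝ} (hg : ∀ x, |g x| ≤ S)
    (x : V) : |(φ.normed μ ⋆[lsmul ℝ ℝ, μ] g) x| ≤ S := by
  have hdom : Integrable (fun y => φ.normed μ y * S) μ := φ.integrable_normed.mul_const S
  have hle := norm_integral_le_of_norm_le (f := fun y => φ.normed μ y * g (x - y)) hdom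
    (Eventually.of_forall fun y => by
      rw [norm_mul, Real.norm_of_nonneg (φ.nonneg_normed y)]
      exact mul_le_mul_of_nonneg_left (hg _) (φ.nonneg_normed y))
  rw [integral_mul_const, φ.integral_normed, one_mul] at hle
  simpa only [convolution, lsmul_apply, smul_eq_mul, Real.norm_eq_abs] using hle

theorem integral_mul_le_of_forall_contDiff (hw : Integrable w μ)
    (hM : ∀ φ : V → ℝ, ContDiff ℝ 1 φ → HasCompactSupport φ → (∀ x, |φ x| ≤ 1) →
      ∫ x, w x * φ x ∂μ ≤ M)
    (hgm : AEStronglyMeasurable g μ) (hgc : HasCompactSupport g) (hg : ∀ x, |g x| ≤ 1) :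
    ∫ x, w x * g x ∂μ ≤ M := by
  have hgl : LocallyIntegrable g μ := (locallyIntegrable_const (1 : ℝ)).mono hgm
    (Eventually.of_forall fun x => by simpa using hg x)
  let φ : ℕ → ContDiffBump (0 : V) := fun n =>
    ⟨1 / (n + 1), 2 * (1 / (n + 1)), by positivity,
      lt_two_mul_self (by positivity)⟩
  have hφ : Tendsto (fun n => (φ n).rOut) atTop (𝓝 0) := by
    simpa only [mul_zero] using (tendsto_one_div_add_atTop_nhds_zero_nat (𝕜 := ℝ)).const_mul 2
  have hsmooth : ∀ n, ContDiff ℝ 1 ((φ n).normed μ ⋆[lsmul ℝ ℝ, μ] g) := fun n =>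
    (φ n).hasCompactSupport_normed.contDiff_convolution_left _ (φ n).contDiff_normed hgl
  have hlim : Tendsto (fun n => ∫ x, w x * ((φ n).normed μ ⋆[lsmul ℝ ℝ, μ] g) x ∂μ) atTop
      (𝓝 (∫ x, w x * g x ∂μ)) := by
    refine tendsto_integral_of_dominated_convergence (fun x => |w x|)
      (fun n => hw.aestronglyMeasurable.mul (hsmooth n).continuous.aestronglyMeasurable)
      hw.abs (fun n => Eventually.of_forall fun x => ?_) ?_
    · rw [norm_mul]
      exact mul_le_of_le_one_right (abs_nonneg _) (abs_convolution_normed_le _ hg x)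
    · filter_upwards [ContDiffBump.ae_convolution_tendsto_right_of_locallyIntegrable (μ := μ)
        (K := 2) hφ (Eventually.of_forall fun n => le_rfl) hgl] with x hx
      exact hx.const_mul (w x)
  exact le_of_tendsto' hlim fun n => hM _ (hsmooth n)
    ((φ n).hasCompactSupport_normed.convolution _ hgc) (abs_convolution_normed_le _ hg)

theorem integral_abs_le_of_forall_contDiff (hw : Integrable w μ)
    (hM : ∀ φ : V → ℝ, ContDiff ℝ 1 φ → HasCompactSupport φ → (∀ x, |φ x| ≤ 1) →
      ∫ x, w x * φ x ∂μ ≤ M) :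
    ∫ x, |w x| ∂μ ≤ M := by
  let g : ℕ → V → ℝ := fun n => (Metric.closedBall 0 n).indicator fun x => w x / |w x|
  have hg : ∀ n x, |g n x| ≤ 1 := fun n x => by
    by_cases hx : x ∈ Metric.closedBall (0 : V) n
    · simp only [g]
      rw [Set.indicator_of_mem hx, abs_div, abs_abs]
      exact div_self_le_one _
    · simp only [g, Set.indicator_of_notMem hx, abs_zero, zero_le_one]
  have hgm : ∀ n, AEStronglyMeasurable (g n) μ := fun n =>
    (hw.aestronglyMeasurable.aemeasurable.div
      hw.abs.aestronglyMeasurable.aemeasurable).aestronglyMeasurable.indicator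
        measurableSet_closedBall
  have hlim : Tendsto (fun n => ∫ x, w x * g n x ∂μ) atTop (𝓝 (∫ x, |w x| ∂μ)) := by
    refine tendsto_integral_of_dominated_convergence (fun x => |w x|)
      (fun n => hw.aestronglyMeasurable.mul (hgm n)) hw.abs
      (fun n => Eventually.of_forall fun x => ?_) (Eventually.of_forall fun x => ?_)
    · rw [norm_mul]
      exact mul_le_of_le_one_right (abs_nonneg _) (hg n x)
    · refine tendsto_const_nhds.congr' ?_
      filter_upwards [eventually_ge_atTop ⌈‖x‖⌉₊] with n hn
      simp only [g]
      rw [Set.indicator_of_mem (mem_closedBall_zero_iff.2 (Nat.ceil_le.1 hn)), ← mul_div_assoc,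
        ← abs_mul_abs_self, mul_self_div_self]
  exact le_of_tendsto' hlim fun n => integral_mul_le_of_forall_contDiff hw hM (hgm n)
    (.intro (isCompact_closedBall 0 n) fun _ hx => Set.indicator_of_notMem hx _) (hg n)

end TestFunctions

section Translation

variable {d : ℕ} {u φ : E d → ℝ}

theorem divergence_smul_const {x : E d} (hφ : DifferentiableAt ℝ φ x) (z : E d) :
    divergence (fun y => φ y • z) x = fderiv ℝ φ x z := by
  conv_rhs => rw [← (EuclideanSpace.basisFun (Fin d) ℝ).sum_repr z, map_sum]
  refine Finset.sum_congr rfl fun i _ => ?_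
  rw [fderiv_smul_const hφ, ContinuousLinearMap.smulRight_apply, PiLp.smul_apply, map_smul,
    smul_eq_mul, smul_eq_mul, mul_comm, EuclideanSpace.basisFun_repr,
    EuclideanSpace.basisFun_apply]

theorem integral_mul_divergence_le (hu : variation u ≠ ∞) {v : E d → E d} (hv : IsTestField v) :
    ∫ x, u x * divergence v x ≤ (variation u).toReal :=
  (ENNReal.ofReal_le_iff_le_toReal hu).1 <| le_iSup₂ (f := fun (v : E d → E d)
    (_ : IsTestField v) => ENNReal.ofReal (∫ x, u x * divergence v x)) v hv

theorem integral_mul_fderiv_le (hu : variation u ≠ ∞) (hφ : ContDiff ℝ 1 φ)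
    (hφc : HasCompactSupport φ) (hφ1 : ∀ x, |φ x| ≤ 1) (z : E d) :
    ∫ x, u x * fderiv ℝ φ x z ≤ ‖z‖ * (variation u).toReal := by
  rcases eq_or_ne z 0 with rfl | hz
  · simp
  have hz' : 0 < ‖z‖ := norm_pos_iff.2 hz
  have hv : IsTestField fun y => φ y • (‖z‖⁻¹ • z) := by
    refine ⟨hφ.smul contDiff_const, hφc.smul_right, fun x => ?_⟩
    rw [norm_smul, norm_smul, norm_inv, norm_norm, inv_mul_cancel₀ hz'.ne', mul_one]
    exact hφ1 x
  have hle := integral_mul_divergence_le hu hv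
  simp only [divergence_smul_const (hφ.differentiable one_ne_zero _), map_smul, smul_eq_mul,
    mul_left_comm _ ‖z‖⁻¹, integral_const_mul] at hle
  rwa [inv_mul_le_iff₀ hz'] at hle

theorem abs_integral_mul_fderiv_le (hu : variation u ≠ ∞) (hφ : ContDiff ℝ 1 φ)
    (hφc : HasCompactSupport φ) (hφ1 : ∀ x, |φ x| ≤ 1) (z : E d) :
    |∫ x, u x * fderiv ℝ φ x z| ≤ ‖z‖ * (variation u).toReal := by
  refine abs_le'.2 ⟨integral_mul_fderiv_le hu hφ hφc hφ1 z, ?_⟩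
  simpa only [map_neg, mul_neg, integral_neg, norm_neg] using
    integral_mul_fderiv_le hu hφ hφc hφ1 (-z)

theorem hasDerivAt_integral_mul_translate (hu : Integrable u) (hφ : ContDiff ℝ 1 φ)
    (hφc : HasCompactSupport φ) (z : E d) (t : ℝ) :
    HasDerivAt (fun s : ℝ => ∫ x, u x * φ (x - s • z))
      (∫ x, u x * fderiv ℝ φ (x - t • z) (-z)) t := by
  have hφ' : Continuous fun x => fderiv ℝ φ x (-z) :=
    (hφ.continuous_fderiv one_ne_zero).clm_apply continuous_const
  obtain ⟨S, hS⟩ := hφ.continuous.bounded_above_of_compact_support hφc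
  obtain ⟨S', hS'⟩ := hφ'.bounded_above_of_compact_support
    ((hφc.fderiv ℝ).mono fun x hx => by contrapose! hx; simp_all)
  have hmul : ∀ {ψ : E d → ℝ}, Continuous ψ → ∀ s : ℝ,
      AEStronglyMeasurable (fun x => u x * ψ (x - s • z)) := fun hψ s =>
    hu.aestronglyMeasurable.mul
      (hψ.comp (continuous_id.sub continuous_const)).aestronglyMeasurable
  refine (hasDerivAt_integral_of_dominated_loc_of_deriv_le (bound := fun x => |u x| * S')
    (F := fun s x => u x * φ (x - s • z)) (F' := fun s x => u x * fderiv ℝ φ (x - s • z) (-z))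
    univ_mem (Eventually.of_forall (hmul hφ.continuous)) ?_ (hmul hφ' t)
    (Eventually.of_forall fun x s _ => ?_) (hu.abs.mul_const S')
    (Eventually.of_forall fun x s _ => ?_)).2
  · exact hu.mul_bdd (hφ.continuous.comp (continuous_id.sub continuous_const)).aestronglyMeasurable
      (Eventually.of_forall fun x => hS _)
  · rw [norm_mul]
    exact mul_le_mul_of_nonneg_left (hS' _) (abs_nonneg _)
  · have hline : HasDerivAt (fun s : ℝ => x - s • z) (-z) s := by
      simpa using ((hasDerivAt_id s).smul_const z).const_sub x
    exact (((hφ.differentiable one_ne_zero _).hasFDerivAt.comp_hasDerivAt s hline)).const_mul (u x)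

theorem integral_translate_sub_mul_le (hu : Integrable u) (hV : variation u ≠ ∞)
    (hφ : ContDiff ℝ 1 φ) (hφc : HasCompactSupport φ) (hφ1 : ∀ x, |φ x| ≤ 1) (z : E d) :
    ∫ x, (u (x + z) - u x) * φ x ≤ ‖z‖ * (variation u).toReal := by
  let H : ℝ → ℝ := fun s => ∫ x, u x * φ (x - s • z)
  have hderiv : ∀ s ∈ Set.Ico (0 : ℝ) 1,
      ‖∫ x, u x * fderiv ℝ φ (x - s • z) (-z)‖ ≤ ‖z‖ * (variation u).toReal := fun s _ => by
    have hφs : ContDiff ℝ 1 fun x => φ (x - s • z) := hφ.comp (contDiff_id.sub contDiff_const)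
    have hcs : HasCompactSupport fun x => φ (x - s • z) :=
      hφc.comp_homeomorph (Homeomorph.subRight (s • z))
    simpa only [fderiv_comp_sub, norm_neg, Real.norm_eq_abs] using
      abs_integral_mul_fderiv_le hV hφs hcs (fun x => hφ1 _) (-z)
  have hH : H 1 - H 0 = ∫ x, (u (x + z) - u x) * φ x := by
    have hbdd : ∀ {w : E d → ℝ}, Integrable w → Integrable fun x => w x * φ x := fun hw => by
      exact hw.mul_bdd hφ.continuous.aestronglyMeasurable (Eventually.of_forall hφ1)
    simp only [H, one_smul, zero_smul, sub_zero, sub_mul]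
    rw [integral_sub (hbdd (hu.comp_add_right z)) (hbdd hu),
      ← integral_add_right_eq_self (fun x => u x * φ (x - z)) z]
    simp only [add_sub_cancel_right]
  rw [← hH]
  exact (le_abs_self _).trans <| norm_image_sub_le_of_norm_deriv_le_segment_01'
    (fun s _ => (hasDerivAt_integral_mul_translate hu hφ hφc z s).hasDerivWithinAt) hderiv

theorem integral_abs_translate_sub_le (hu : Integrable u) (hV : variation u ≠ ∞) (z : E d) :
    ∫ x, |u (x + z) - u x| ≤ ‖z‖ * (variation u).toReal :=
  integral_abs_le_of_forall_contDiff ((hu.comp_add_right z).sub hu) fun _ hφ hφc hφ1 =>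
    integral_translate_sub_mul_le hu hV hφ hφc hφ1 z

end Translation

/-! ### Boxes and dyadic averages -/

section Boxes

variable {d : ℕ}

/-- The half-open box `∏ [a i, b i)`. -/
def halfOpenBox (a b : Fin d → ℝ) : Set (E d) := {x | ∀ i, a i ≤ x i ∧ x i < b i}

theorem box_eq_preimage (a b : Fin d → ℝ) :
    box a b = WithLp.ofLp ⁻¹' (Set.univ.pi fun i => Set.Icc (a i) (b i)) := by
  ext x
  exact ⟨fun h i _ => h i, fun h i => h i trivial⟩

theorem isCompact_box (a b : Fin d → ℝ) : IsCompact (box a b) := by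
  rw [box_eq_preimage]
  exact (PiLp.homeomorph 2 fun _ : Fin d => ℝ).isCompact_preimage.2
    (isCompact_univ_pi fun i => isCompact_Icc)

theorem measurableSet_box (a b : Fin d → ℝ) : MeasurableSet (box a b) :=
  (isCompact_box a b).isClosed.measurableSet

theorem volume_real_box {a b : Fin d → ℝ} (hab : ∀ i, a i ≤ b i) :
    volume.real (box a b) = ∏ i, (b i - a i) := by
  rw [Measure.real, box_eq_preimage, (PiLp.volume_preserving_ofLp (Fin d)).measure_preimage
    (MeasurableSet.univ_pi fun i => measurableSet_Icc).nullMeasurableSet, Set.pi_univ_Icc,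
    Real.volume_Icc_pi_toReal hab]

theorem halfOpenBox_ae_eq_box (a b : Fin d → ℝ) : halfOpenBox a b =ᵐ[volume] box a b := by
  have hne : ∀ᵐ x : E d, ∀ i, x i ≠ b i := ae_all_iff.2 fun i =>
    (PiLp.volume_preserving_ofLp (Fin d)).quasiMeasurePreserving.ae
      (Measure.ae_eval_ne (fun _ : Fin d => (volume : Measure ℝ)) i (b i))
  filter_upwards [hne] with x hx
  exact propext ⟨fun h i => ⟨(h i).1, (h i).2.le⟩,
    fun h i => ⟨(h i).1, (h i).2.lt_of_ne (hx i)⟩⟩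

theorem measurableSet_halfOpenBox (a b : Fin d → ℝ) : MeasurableSet (halfOpenBox a b) := by
  simp only [halfOpenBox, Set.ofPred_forall]
  exact MeasurableSet.iInter fun i => measurableSet_Ico.preimage (f := fun x : E d => x i)
    (by fun_prop)

theorem norm_le_mul_of_mem_box {h : ℝ} {z : E d} (hz : z ∈ box (fun _ => -h) fun _ => h) :
    ‖z‖ ≤ d * h := by
  rw [← (EuclideanSpace.basisFun (Fin d) ℝ).sum_repr z]
  calc ‖∑ i, (EuclideanSpace.basisFun (Fin d) ℝ).repr z i • EuclideanSpace.basisFun (Fin d) ℝ i‖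
      ≤ ∑ _i : Fin d, h := norm_sum_le_of_le _ fun i _ => by
        rw [norm_smul, OrthonormalBasis.norm_eq_one, mul_one]
        exact abs_le.2 (hz i)
    _ = d * h := by simp

end Boxes

section DyadicAverage

variable {d : ℕ} {n : ℕ} {u g : E d → ℝ} {S : ℝ}

/-- The integer vector `k` such that `x` lies in the half-open dyadic cube
`∏ [2^{-n} k i, 2^{-n} (k i + 1))`. -/
noncomputable def dyadicIndex (n : ℕ) (x : E d) : Fin d → ℤ := fun i => ⌊2 ^ n * x i⌋

/-- The half-open dyadic cube of side `2^{-n}` that contains `x`. -/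
def dyadicCell (n : ℕ) (x : E d) : Set (E d) := {y | dyadicIndex n y = dyadicIndex n x}

/-- The point `2^{-n} k` of the dyadic grid of level `n`. -/
noncomputable def gridPoint (n : ℕ) (k : Fin d → ℤ) : Fin d → ℝ := fun i => k i / 2 ^ n

/-- The function whose value at `x` is the mean of `g` over the dyadic cube of side `2^{-n}` that
contains `x`. -/
noncomputable def dyadicAverage (n : ℕ) (g : E d → ℝ) (x : E d) : ℝ := ⨍ y in dyadicCell n x, g y

theorem measurable_dyadicIndex : Measurable (dyadicIndex n : E d → Fin d → ℤ) :=
  measurable_pi_lambda _ fun i => Int.measurable_floor.comp (by fun_prop)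

theorem dyadicIndex_eq_iff {x : E d} {k : Fin d → ℤ} :
    dyadicIndex n x = k ↔ x ∈ halfOpenBox (gridPoint n k) (gridPoint n (k + 1)) := by
  have h2 : (0 : ℝ) < 2 ^ n := by positivity
  simp only [funext_iff, dyadicIndex, Int.floor_eq_iff, halfOpenBox, gridPoint, Set.mem_ofPred_eq,
    div_le_iff₀' h2, lt_div_iff₀' h2, Pi.add_apply, Pi.one_apply, Int.cast_add, Int.cast_one]

theorem dyadicCell_eq_halfOpenBox (n : ℕ) (x : E d) : dyadicCell n x =
    halfOpenBox (gridPoint n (dyadicIndex n x)) (gridPoint n (dyadicIndex n x + 1)) :=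
  Set.ext fun _ => dyadicIndex_eq_iff

theorem volume_real_halfOpenBox_gridPoint (n : ℕ) (k : Fin d → ℤ) :
    volume.real (halfOpenBox (gridPoint n k) (gridPoint n (k + 1))) = (1 / 2 ^ n) ^ d := by
  rw [measureReal_congr (halfOpenBox_ae_eq_box _ _), volume_real_box fun i => by
    simp only [gridPoint, Pi.add_apply, Pi.one_apply]; gcongr; simp]
  simp [gridPoint, ← sub_div]

theorem volume_real_dyadicCell (n : ℕ) (x : E d) :
    volume.real (dyadicCell n x) = (1 / 2 ^ n) ^ d := by
  rw [dyadicCell_eq_halfOpenBox, volume_real_halfOpenBox_gridPoint]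

theorem volume_dyadicCell_ne_top (n : ℕ) (x : E d) : volume (dyadicCell n x) ≠ ∞ := by
  rw [dyadicCell_eq_halfOpenBox, measure_congr (halfOpenBox_ae_eq_box _ _)]
  exact (isCompact_box _ _).measure_ne_top

theorem measurableSet_dyadicCell (n : ℕ) (x : E d) : MeasurableSet (dyadicCell n x) :=
  measurable_dyadicIndex (measurableSet_singleton _)

/-- The relation of lying in the same dyadic cube of side `2^{-n}`, as a subset of `E d × E d`. -/
def sameCell (d n : ℕ) : Set (E d × E d) := {p | p.2 ∈ dyadicCell n p.1}

theorem measurableSet_sameCell (d n : ℕ) : MeasurableSet (sameCell d n) :=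
  measurableSet_eq_fun (measurable_dyadicIndex.comp measurable_snd)
    (measurable_dyadicIndex.comp measurable_fst)

theorem sub_mem_box_of_mem_dyadicCell {x y : E d} (h : y ∈ dyadicCell n x) :
    y - x ∈ box (fun _ => -(1 / 2 ^ n)) fun _ => 1 / 2 ^ n := by
  intro i
  have h2 : (0 : ℝ) < 2 ^ n := by positivity
  have := Int.abs_sub_lt_one_of_floor_eq_floor (congrFun h i)
  rw [← abs_le, PiLp.sub_apply, le_div_iff₀' h2]
  rw [← mul_sub, abs_mul, abs_of_pos h2] at this
  exact this.le

theorem setIntegral_sameCell {F : E d × E d → ℝ}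
    (hF : IntegrableOn F (sameCell d n) (volume.prod volume)) :
    ∫ p in sameCell d n, F p ∂(volume.prod volume) = ∫ x, ∫ y in dyadicCell n x, F (x, y) := by
  rw [← integral_indicator (measurableSet_sameCell d n), integral_prod _
    ((integrable_indicator_iff (measurableSet_sameCell d n)).2 hF)]
  refine integral_congr_ae (Eventually.of_forall fun x => ?_)
  exact integral_indicator (f := fun y => F (x, y)) (measurableSet_dyadicCell n x)

theorem preimage_swap_sameCell : Prod.swap ⁻¹' sameCell d n = sameCell d n :=
  Set.ext fun _ => eq_comm

theorem setIntegral_sameCell_swap (F : E d × E d → ℝ) :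
    ∫ p in sameCell d n, F p.swap ∂(volume.prod volume)
      = ∫ p in sameCell d n, F p ∂(volume.prod volume) := by
  have hswap := (Measure.measurePreserving_swap (μ := (volume : Measure (E d)))
    (ν := (volume : Measure (E d)))).setIntegral_preimage_emb
    MeasurableEquiv.prodComm.measurableEmbedding F (sameCell d n)
  rwa [preimage_swap_sameCell] at hswap

theorem integrableOn_sameCell_fst (hu : Integrable u) :
    IntegrableOn (fun p => u p.1) (sameCell d n) (volume.prod volume) := by
  have hsm : AEStronglyMeasurable ((sameCell d n).indicator fun p => u p.1)
      (volume.prod volume) :=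
    hu.aestronglyMeasurable.comp_fst.indicator (measurableSet_sameCell d n)
  have hcell : ∀ (w : E d → ℝ) (x : E d),
      (fun y => (sameCell d n).indicator (fun p => w p.1) (x, y))
        = (dyadicCell n x).indicator fun _ => w x := fun _ _ => rfl
  rw [← integrable_indicator_iff (measurableSet_sameCell d n), integrable_prod_iff hsm]
  simp only [norm_indicator_eq_indicator_norm, hcell u, hcell fun x => ‖u x‖]
  refine ⟨Eventually.of_forall fun x => ?_, ?_⟩
  · exact (integrable_indicator_iff (measurableSet_dyadicCell n x)).2
      (integrableOn_const (volume_dyadicCell_ne_top n x))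
  · simp only [integral_indicator (measurableSet_dyadicCell n _), setIntegral_const,
      volume_real_dyadicCell, smul_eq_mul]
    exact hu.norm.const_mul _

theorem integrableOn_sameCell_snd (hu : Integrable u) :
    IntegrableOn (fun p => u p.2) (sameCell d n) (volume.prod volume) := by
  have hswap := (Measure.measurePreserving_swap.integrableOn_comp_preimage
    MeasurableEquiv.prodComm.measurableEmbedding).2 (integrableOn_sameCell_fst (n := n) hu)
  rwa [preimage_swap_sameCell] at hswap

theorem setIntegral_dyadicCell (n : ℕ) (g : E d → ℝ) (x : E d) :
    ∫ y in dyadicCell n x, g y = (1 / 2 ^ n) ^ d * dyadicAverage n g x := by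
  rw [dyadicAverage, setAverage_eq, volume_real_dyadicCell, smul_eq_mul,
    mul_inv_cancel_left₀ (by positivity)]

theorem setIntegral_dyadicCell_sub (hgm : AEStronglyMeasurable g) (hg : ∀ x, |g x| ≤ S) (n : ℕ)
    (x : E d) :
    ∫ y in dyadicCell n x, (g x - g y) = (1 / 2 ^ n) ^ d * (g x - dyadicAverage n g x) := by
  rw [integral_sub (integrableOn_const (volume_dyadicCell_ne_top n x)).integrable
    (Measure.integrableOn_of_bounded (volume_dyadicCell_ne_top n x) hgm
      (Eventually.of_forall hg)),
    setIntegral_const, setIntegral_dyadicCell, volume_real_dyadicCell, smul_eq_mul, mul_sub]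

theorem integral_mul_sub_dyadicAverage (hu : Integrable u) (hgm : AEStronglyMeasurable g)
    (hg : ∀ x, |g x| ≤ S) :
    (1 / 2 ^ n) ^ d * ∫ x, u x * (g x - dyadicAverage n g x)
      = ∫ p in sameCell d n, (u p.2 - u p.1) * g p.2 ∂(volume.prod volume) := by
  have hi₁ := (integrableOn_sameCell_fst (n := n) hu).mul_bdd hgm.comp_fst.restrict
    (Eventually.of_forall fun p => hg p.1)
  have hi₂ := (integrableOn_sameCell_fst (n := n) hu).mul_bdd hgm.comp_snd.restrict
    (Eventually.of_forall fun p => hg p.2)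
  have hi₃ := (integrableOn_sameCell_snd (n := n) hu).mul_bdd hgm.comp_snd.restrict
    (Eventually.of_forall fun p => hg p.2)
  calc (1 / 2 ^ n) ^ d * ∫ x, u x * (g x - dyadicAverage n g x)
      = ∫ x, ∫ y in dyadicCell n x, u x * (g x - g y) := by
        simp only [integral_const_mul, setIntegral_dyadicCell_sub hgm hg,
          mul_left_comm _ ((1 / 2 ^ n : ℝ) ^ d)]
    _ = ∫ p in sameCell d n, u p.1 * (g p.1 - g p.2) ∂(volume.prod volume) :=
        (setIntegral_sameCell ((hi₁.sub hi₂).congr (Eventually.of_forall fun p =>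
          (mul_sub (u p.1) (g p.1) (g p.2)).symm))).symm
    _ = (∫ p in sameCell d n, u p.1 * g p.1 ∂(volume.prod volume))
          - ∫ p in sameCell d n, u p.1 * g p.2 ∂(volume.prod volume) := by
        simp only [mul_sub]
        exact integral_sub hi₁ hi₂
    _ = (∫ p in sameCell d n, u p.2 * g p.2 ∂(volume.prod volume))
          - ∫ p in sameCell d n, u p.1 * g p.2 ∂(volume.prod volume) := by
        rw [← setIntegral_sameCell_swap fun p => u p.1 * g p.1]
        rfl
    _ = ∫ p in sameCell d n, (u p.2 - u p.1) * g p.2 ∂(volume.prod volume) := by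
        simp only [sub_mul]
        exact (integral_sub hi₃ hi₂).symm

theorem integral_indicator_abs_translate_sub_le (hu : Integrable u) (hV : variation u ≠ ∞)
    (n : ℕ) (z : E d) :
    ∫ x, {x | x + z ∈ dyadicCell n x}.indicator (fun x => |u (x + z) - u x|) x
      ≤ (box (fun _ => -(1 / 2 ^ n)) fun _ => 1 / 2 ^ n).indicator
          (fun _ => d / 2 ^ n * (variation u).toReal) z := by
  by_cases hz : z ∈ box (fun _ => -(1 / 2 ^ n)) fun _ => 1 / 2 ^ n
  · rw [Set.indicator_of_mem hz]
    calc ∫ x, {x | x + z ∈ dyadicCell n x}.indicator (fun x => |u (x + z) - u x|) x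
        ≤ ∫ x, |u (x + z) - u x| :=
          integral_mono_of_nonneg
            (Eventually.of_forall fun x => Set.indicator_nonneg (fun _ _ => abs_nonneg _) _)
            ((hu.comp_add_right z).sub hu).abs
            (Eventually.of_forall fun x => Set.indicator_le_self' (fun _ _ => abs_nonneg _) _)
      _ ≤ ‖z‖ * (variation u).toReal := integral_abs_translate_sub_le hu hV z
      _ ≤ d / 2 ^ n * (variation u).toReal := by
          gcongr
          simpa only [mul_one_div] using norm_le_mul_of_mem_box hz
  · have hcell : ∀ x, x ∉ {x | x + z ∈ dyadicCell n x} := fun x hx =>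
      hz (by simpa only [add_sub_cancel_left] using sub_mem_box_of_mem_dyadicCell hx)
    simp only [Set.indicator_of_notMem (hcell _), Set.indicator_of_notMem hz, integral_zero,
      le_refl]

theorem setIntegral_sameCell_abs_sub_le (hu : Integrable u) (hV : variation u ≠ ∞) (n : ℕ) :
    ∫ p in sameCell d n, |u p.2 - u p.1| ∂(volume.prod volume)
      ≤ (2 / 2 ^ n) ^ d * (d / 2 ^ n * (variation u).toReal) := by
  -- The substitution `y = x + z` turns the integral over pairs into an integral over translations.
  have hshear := measurePreserving_prod_add (volume : Measure (E d)) (volume : Measure (E d))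
  have hemb : MeasurableEmbedding fun p : E d × E d => (p.1, p.1 + p.2) :=
    (MeasurableEquiv.shearAddRight (E d)).measurableEmbedding
  let T : Set (E d × E d) := {p | p.1 + p.2 ∈ dyadicCell n p.1}
  have hT : MeasurableSet T := hemb.measurable (measurableSet_sameCell d n)
  have hTint : Integrable (T.indicator fun p => |u (p.1 + p.2) - u p.1|) (volume.prod volume) :=
    (integrable_indicator_iff hT).2 <| (hshear.integrableOn_comp_preimage hemb).2
      ((integrableOn_sameCell_snd hu).sub (integrableOn_sameCell_fst hu)).abs
  calc ∫ p in sameCell d n, |u p.2 - u p.1| ∂(volume.prod volume)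
      = ∫ p in T, |u (p.1 + p.2) - u p.1| ∂(volume.prod volume) :=
        (hshear.setIntegral_preimage_emb hemb (fun p => |u p.2 - u p.1|) _).symm
    _ = ∫ z, ∫ x, T.indicator (fun p => |u (p.1 + p.2) - u p.1|) (x, z) := by
        rw [← integral_indicator hT, integral_prod_symm _ hTint]
    _ ≤ ∫ z, (box (fun _ => -(1 / 2 ^ n)) fun _ => 1 / 2 ^ n).indicator
          (fun _ => d / 2 ^ n * (variation u).toReal) z :=
        integral_mono hTint.integral_prod_right
          ((integrable_indicator_iff (measurableSet_box _ _)).2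
            (integrableOn_const (isCompact_box _ _).measure_ne_top))
          (integral_indicator_abs_translate_sub_le hu hV n)
    _ = (2 / 2 ^ n) ^ d * (d / 2 ^ n * (variation u).toReal) := by
        rw [integral_indicator (measurableSet_box _ _), setIntegral_const, smul_eq_mul,
          volume_real_box fun _ => neg_le_self (by positivity)]
        simp only [sub_neg_eq_add, ← add_div, one_add_one_eq_two, Finset.prod_const,
          Finset.card_univ, Fintype.card_fin]

theorem abs_integral_mul_sub_dyadicAverage_le (hu : Integrable u) (hV : variation u ≠ ∞)
    (hgm : AEStronglyMeasurable g) (hg : ∀ x, |g x| ≤ S) :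
    |∫ x, u x * (g x - dyadicAverage n g x)| ≤ 2 ^ d * d * (S / 2 ^ n) * (variation u).toReal := by
  have hcell : (0 : ℝ) < (1 / 2 ^ n) ^ d := by positivity
  have hS : 0 ≤ S := (abs_nonneg _).trans (hg 0)
  have hdiff : IntegrableOn (fun p => u p.2 - u p.1) (sameCell d n) (volume.prod volume) :=
    (integrableOn_sameCell_snd hu).sub (integrableOn_sameCell_fst hu)
  rw [← mul_le_mul_iff_right₀ hcell, ← abs_of_pos hcell, ← abs_mul, abs_of_pos hcell,
    integral_mul_sub_dyadicAverage hu hgm hg]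
  calc |∫ p in sameCell d n, (u p.2 - u p.1) * g p.2 ∂(volume.prod volume)|
      ≤ ∫ p in sameCell d n, |u p.2 - u p.1| * S ∂(volume.prod volume) :=
        norm_integral_le_of_norm_le (f := fun p => (u p.2 - u p.1) * g p.2)
          (hdiff.abs.mul_const S) <| Eventually.of_forall fun p =>
          (norm_mul _ _).trans_le (mul_le_mul_of_nonneg_left (hg _) (abs_nonneg _))
    _ ≤ (2 / 2 ^ n) ^ d * (d / 2 ^ n * (variation u).toReal) * S := by
        rw [integral_mul_const]
        exact mul_le_mul_of_nonneg_right (setIntegral_sameCell_abs_sub_le hu hV n) hS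
    _ = (1 / 2 ^ n) ^ d * (2 ^ d * d * (S / 2 ^ n) * (variation u).toReal) := by
        ring

end DyadicAverage

/-! ### Increments and dyadic step densities -/

section Increments

variable {d : ℕ} {f : E d → ℝ} {a b : Fin d → ℝ}

theorem increment_eq_sum_powerset (f : E d → ℝ) (a b : Fin d → ℝ) (i : Fin d) :
    increment f a b = ∑ s ∈ (Finset.univ.erase i).powerset, (-1 : ℝ) ^ s.card *
      (f (WithLp.toLp 2 fun j => if j ∈ s then a j else b j) -
        f (WithLp.toLp 2 fun j => if j ∈ insert i s then a j else b j)) := by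
  rw [increment, ← Finset.powerset_univ, ← Finset.insert_erase (Finset.mem_univ i),
    Finset.sum_powerset_insert (Finset.notMem_erase i _), ← Finset.sum_add_distrib,
    Finset.erase_insert (Finset.notMem_erase i _)]
  refine Finset.sum_congr rfl fun s hs => ?_
  rw [Finset.card_insert_of_notMem fun h => Finset.notMem_erase i _ (Finset.mem_powerset.1 hs h)]
  ring

theorem increment_split (f : E d → ℝ) (a b : Fin d → ℝ) (i : Fin d) (c : ℝ) :
    increment f a b =
      increment f a (Function.update b i c) + increment f (Function.update a i c) b := by
  rw [increment_eq_sum_powerset f a b i, increment_eq_sum_powerset f a _ i,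
    increment_eq_sum_powerset f _ b i, ← Finset.sum_add_distrib]
  refine Finset.sum_congr rfl fun s hs => ?_
  have : i ∉ s := fun h => Finset.notMem_erase i _ (Finset.mem_powerset.1 hs h)
  have lower_face : (fun j => if j ∈ insert i s then a j else Function.update b i c j) =
      fun j => if j ∈ insert i s then a j else b j := by
    grind
  have upper_face : (fun j => if j ∈ s then Function.update a i c j else b j) =
      fun j => if j ∈ s then a j else b j := by
    grind
  have common_face : (fun j => if j ∈ insert i s then Function.update a i c j else b j) =
      fun j => if j ∈ s then a j else Function.update b i c j := by
    grind
  rw [lower_face, upper_face, common_face]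
  ring

theorem increment_eq_zero_of_eq {i : Fin d} (h : a i = b i) : increment f a b = 0 := by
  have hsplit := increment_split f a b i (b i)
  rw [Function.update_eq_self, ← h, Function.update_eq_self] at hsplit
  linarith

theorem increment_comp (f : E d → ℝ) (p : ℝ → ℝ) (a b : Fin d → ℝ) :
    increment (fun x => f (WithLp.toLp 2 fun i => p (x i))) a b = increment f (p ∘ a) (p ∘ b) :=
  Finset.sum_congr rfl fun s _ => by simp only [Function.comp_apply, apply_ite p]

theorem tendsto_increment (hf : Continuous f) {ι : Type*} {l : Filter ι} {a' b' : ι → Fin d → ℝ}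
    (ha : Tendsto a' l (𝓝 a)) (hb : Tendsto b' l (𝓝 b)) :
    Tendsto (fun n => increment f (a' n) (b' n)) l (𝓝 (increment f a b)) := by
  refine tendsto_finsetSum _ fun s _ => tendsto_const_nhds.mul <| (hf.tendsto _).comp <|
    ((PiLp.continuous_toLp 2 fun _ : Fin d => ℝ).tendsto _).comp <| tendsto_pi_nhds.2 fun i => ?_
  split_ifs
  · exact tendsto_pi_nhds.1 ha i
  · exact tendsto_pi_nhds.1 hb i

theorem halfOpenBox_eq_union {i : Fin d} {c : ℝ} (hac : a i ≤ c) (hcb : c ≤ b i) :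
    halfOpenBox a b =
      halfOpenBox a (Function.update b i c) ∪ halfOpenBox (Function.update a i c) b := by
  ext x
  simp only [halfOpenBox, Set.mem_union, Set.mem_ofPred_eq]
  refine ⟨fun h => ?_, ?_⟩
  · rcases lt_or_ge (x i) c with hx | hx
    · refine .inl fun j => ⟨(h j).1, ?_⟩
      rcases eq_or_ne j i with rfl | hj <;> simp_all
    · refine .inr fun j => ⟨?_, (h j).2⟩
      rcases eq_or_ne j i with rfl | hj <;> simp_all
  · rintro (h | h) j <;> have := h j <;> have := h i <;> grind

theorem disjoint_halfOpenBox_update (a b : Fin d → ℝ) (i : Fin d) (c : ℝ) :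
    Disjoint (halfOpenBox a (Function.update b i c)) (halfOpenBox (Function.update a i c) b) :=
  Set.disjoint_left.2 fun x hx hx' => by
    have := (hx i).2
    have := (hx' i).1
    simp_all [not_lt_of_ge]

theorem box_induction {P : (Fin d → ℤ) → (Fin d → ℤ) → Prop} (cell : ∀ k, P k (k + 1))
    (glue : ∀ a b i c, a i < c → c < b i → P a (Function.update b i c) →
      P (Function.update a i c) b → P a b)
    (a b : Fin d → ℤ) (hab : ∀ i, a i < b i) : P a b := by
  induction hN : ∑ i, (b i - a i).toNat using Nat.strong_induction_on generalizing a b with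
  | _ N ih =>
    subst hN
    by_cases hcell : ∀ i, b i = a i + 1
    · obtain rfl : b = a + 1 := funext hcell
      exact cell a
    push Not at hcell
    obtain ⟨i, hi⟩ := hcell
    have hlt : a i + 1 < b i := lt_of_le_of_ne (hab i) hi.symm
    refine glue a b i (a i + 1) (lt_add_one _) hlt (ih _ ?_ _ _ ?_ rfl) (ih _ ?_ _ _ ?_ rfl)
    · refine Finset.sum_lt_sum (fun j _ => ?_) ⟨i, Finset.mem_univ i, ?_⟩ <;> grind
    · grind
    · refine Finset.sum_lt_sum (fun j _ => ?_) ⟨i, Finset.mem_univ i, ?_⟩ <;> grind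
    · grind

end Increments

section DyadicDensity

variable {d : ℕ} {f : E d → ℝ} {n : ℕ}

/-- The density of the increments of `f` at scale `2^{-n}`: the function that is constant on the
half-open dyadic cubes of side `2^{-n}` and whose integral over each of them is the increment
of `f`. -/
noncomputable def dyadicDensity (f : E d → ℝ) (n : ℕ) (x : E d) : ℝ :=
  (2 ^ n) ^ d * increment f (gridPoint n (dyadicIndex n x)) (gridPoint n (dyadicIndex n x + 1))

theorem measurable_dyadicDensity (f : E d → ℝ) (n : ℕ) : Measurable (dyadicDensity f n) :=
  (measurable_of_countable fun k : Fin d → ℤ =>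
    (2 ^ n) ^ d * increment f (gridPoint n k) (gridPoint n (k + 1))).comp measurable_dyadicIndex

theorem abs_dyadicDensity_le {S : ℝ}
    (hS : ∀ k, |increment f (gridPoint n k) (gridPoint n (k + 1))| ≤ S) (x : E d) :
    |dyadicDensity f n x| ≤ (2 ^ n) ^ d * S := by
  rw [dyadicDensity, abs_mul, abs_of_pos (by positivity)]
  gcongr
  exact hS _

theorem gridPoint_update (n : ℕ) (k : Fin d → ℤ) (i : Fin d) (c : ℤ) :
    gridPoint n (Function.update k i c) = Function.update (gridPoint n k) i (c / 2 ^ n) := by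
  ext j
  rcases eq_or_ne j i with rfl | hj <;> simp_all [gridPoint]

theorem integrableOn_and_setIntegral_dyadicDensity_cell (f : E d → ℝ) (n : ℕ) (k : Fin d → ℤ) :
    IntegrableOn (dyadicDensity f n) (halfOpenBox (gridPoint n k) (gridPoint n (k + 1))) ∧
      ∫ x in halfOpenBox (gridPoint n k) (gridPoint n (k + 1)), dyadicDensity f n x =
        increment f (gridPoint n k) (gridPoint n (k + 1)) := by
  have hconst : Set.EqOn (dyadicDensity f n)
      (fun _ => (2 ^ n) ^ d * increment f (gridPoint n k) (gridPoint n (k + 1)))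
      (halfOpenBox (gridPoint n k) (gridPoint n (k + 1))) := fun x hx => by
    rw [dyadicDensity, dyadicIndex_eq_iff.2 hx]
  have hfin : volume (halfOpenBox (gridPoint n k) (gridPoint n (k + 1))) ≠ ∞ := by
    rw [measure_congr (halfOpenBox_ae_eq_box _ _)]
    exact (isCompact_box _ _).measure_ne_top
  refine ⟨(integrableOn_const hfin).congr_fun hconst.symm (measurableSet_halfOpenBox _ _), ?_⟩
  rw [setIntegral_congr_fun (measurableSet_halfOpenBox _ _) hconst, setIntegral_const,
    volume_real_halfOpenBox_gridPoint, smul_eq_mul, ← mul_assoc, ← mul_pow,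
    one_div_mul_cancel (by positivity), one_pow, one_mul]

theorem setIntegral_halfOpenBox_dyadicDensity (f : E d → ℝ) (n : ℕ) {a b : Fin d → ℤ}
    (hab : ∀ i, a i < b i) :
    ∫ x in halfOpenBox (gridPoint n a) (gridPoint n b), dyadicDensity f n x =
      increment f (gridPoint n a) (gridPoint n b) := by
  refine (box_induction (P := fun a b =>
    IntegrableOn (dyadicDensity f n) (halfOpenBox (gridPoint n a) (gridPoint n b)) ∧
      ∫ x in halfOpenBox (gridPoint n a) (gridPoint n b), dyadicDensity f n x =
        increment f (gridPoint n a) (gridPoint n b))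
    (integrableOn_and_setIntegral_dyadicDensity_cell f n) ?_ a b hab).2
  intro a b i c hac hcb ihl ihr
  rw [gridPoint_update] at ihl ihr
  rw [halfOpenBox_eq_union (i := i) (c := c / 2 ^ n) (by simp only [gridPoint]; gcongr)
    (by simp only [gridPoint]; gcongr)]
  refine ⟨ihl.1.union ihr.1, ?_⟩
  rw [setIntegral_union (disjoint_halfOpenBox_update _ _ _ _) (measurableSet_halfOpenBox _ _)
    ihl.1 ihr.1, ihl.2, ihr.2, ← increment_split]

theorem setIntegral_box_dyadicDensity (f : E d → ℝ) (n : ℕ) {a b : Fin d → ℤ}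
    (hab : ∀ i, a i < b i) :
    ∫ x in box (gridPoint n a) (gridPoint n b), dyadicDensity f n x =
      increment f (gridPoint n a) (gridPoint n b) := by
  rw [← setIntegral_congr_set (halfOpenBox_ae_eq_box _ _),
    setIntegral_halfOpenBox_dyadicDensity f n hab]

theorem gridPoint_add (n m : ℕ) (k : Fin d → ℤ) :
    gridPoint (n + m) (2 ^ m * k) = gridPoint n k := by
  ext i
  simp only [gridPoint, Pi.mul_apply, Pi.pow_apply, Pi.ofNat_apply, Int.cast_mul, Int.cast_pow,
    Int.cast_ofNat, pow_add]
  field_simp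

theorem dyadicAverage_dyadicDensity_succ (f : E d → ℝ) (n : ℕ) (x : E d) :
    dyadicAverage n (dyadicDensity f (n + 1)) x = dyadicDensity f n x := by
  have hcell := setIntegral_dyadicCell n (dyadicDensity f (n + 1)) x
  rw [dyadicCell_eq_halfOpenBox, ← gridPoint_add n 1, ← gridPoint_add n 1,
    setIntegral_halfOpenBox_dyadicDensity f (n + 1) (by simp), gridPoint_add,
    gridPoint_add] at hcell
  rw [dyadicDensity, hcell, ← mul_assoc, ← mul_pow, mul_one_div_cancel (by positivity), one_pow,
    one_mul]

end DyadicDensity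

/-! ### Rectangles are `BV`-sets -/

section Rectangles

theorem setIntegral_box_divergence {n : ℕ} {a b : Fin (n + 1) → ℝ} (hab : a ≤ b)
    {v : E (n + 1) → E (n + 1)} (hv : ContDiff ℝ 1 v) :
    ∫ x in box a b, divergence v x = ∑ i,
      ((∫ y in Set.Icc (a ∘ i.succAbove) (b ∘ i.succAbove),
          v (WithLp.toLp 2 (i.insertNth (b i) y)) i) -
        ∫ y in Set.Icc (a ∘ i.succAbove) (b ∘ i.succAbove),
          v (WithLp.toLp 2 (i.insertNth (a i) y)) i) := by
  let L : (Fin (n + 1) → ℝ) →L[ℝ] E (n + 1) :=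
    ((EuclideanSpace.equiv (Fin (n + 1)) ℝ).symm : (Fin (n + 1) → ℝ) →L[ℝ] E (n + 1))
  let v' (i : Fin (n + 1)) (y : Fin (n + 1) → ℝ) : (Fin (n + 1) → ℝ) →L[ℝ] ℝ :=
    EuclideanSpace.proj i ∘L fderiv ℝ v (L y) ∘L L
  have hderiv (i : Fin (n + 1)) (y : Fin (n + 1) → ℝ) :
      HasFDerivAt (fun y => v (L y) i) (v' i y) y :=
    (EuclideanSpace.proj i : E (n + 1) →L[ℝ] ℝ).hasFDerivAt.comp y <|
      ((hv.differentiable one_ne_zero) (L y)).hasFDerivAt.comp y L.hasFDerivAt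
  have hv'_cont : Continuous fun y => ∑ i, v' i y (Pi.single i 1) := by
    have := hv.continuous_fderiv one_ne_zero
    fun_prop
  have hpre : (WithLp.toLp 2 : (Fin (n + 1) → ℝ) → E (n + 1)) ⁻¹' box a b = Set.Icc a b :=
    Set.ext fun y => ⟨fun h => ⟨fun i => (h i).1, fun i => (h i).2⟩, fun h i => ⟨h.1 i, h.2 i⟩⟩
  rw [← (PiLp.volume_preserving_toLp (Fin (n + 1))).setIntegral_preimage_emb
    (MeasurableEquiv.toLp 2 (Fin (n + 1) → ℝ)).measurableEmbedding, hpre]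
  exact integral_divergence_of_hasFDerivAt_off_countable' a b hab (fun i y => v (L y) i) v' ∅
    Set.countable_empty
    (fun i => (continuous_iff_continuousAt.2 fun y => (hderiv i y).continuousAt).continuousOn)
    (fun y _ i => hderiv i y) (hv'_cont.continuousOn.integrableOn_compact isCompact_Icc)

variable {d : ℕ} {a b : Fin d → ℝ}

theorem IsRectangle.abs_integral_face_le {n : ℕ} {a b : Fin (n + 1) → ℝ} (h : IsRectangle a b)
    {v : E (n + 1) → E (n + 1)} (hv : ∀ x, ‖v x‖ ≤ 1) (i : Fin (n + 1)) (c : ℝ) :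
    |∫ y in Set.Icc (a ∘ i.succAbove) (b ∘ i.succAbove),
      v (WithLp.toLp 2 (i.insertNth c y)) i| ≤ 1 := by
  refine (norm_setIntegral_le_of_norm_le_const isCompact_Icc.measure_lt_top fun y _ =>
    (PiLp.norm_apply_le _ i).trans (hv _)).trans ?_
  rw [one_mul, Measure.real, Real.volume_Icc_pi_toReal (a := a ∘ i.succAbove)
    (b := b ∘ i.succAbove) fun j => (h _).2.1.le]
  exact Finset.prod_le_one (fun j _ => sub_nonneg.2 (h _).2.1.le) fun j _ => by
    have := h (i.succAbove j)
    simp only [Function.comp_apply]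
    linarith

theorem IsRectangle.setIntegral_divergence_le (h : IsRectangle a b) {v : E d → E d}
    (hv : ContDiff ℝ 1 v) (hv1 : ∀ x, ‖v x‖ ≤ 1) : ∫ x in box a b, divergence v x ≤ 2 * d := by
  cases d with
  | zero => simp [divergence]
  | succ n =>
    calc ∫ x in box a b, divergence v x ≤ ∑ _i : Fin (n + 1), (2 : ℝ) := by
          rw [setIntegral_box_divergence (fun i => (h i).2.1.le) hv]
          refine Finset.sum_le_sum fun i _ => ?_
          have hupper := abs_le.1 (h.abs_integral_face_le hv1 i (b i))
          have hlower := abs_le.1 (h.abs_integral_face_le hv1 i (a i))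
          linarith
      _ = 2 * ((n + 1 : ℕ) : ℝ) := by simp [mul_comm]

theorem IsRectangle.perimeter_box_le (h : IsRectangle a b) :
    perimeter (box a b) ≤ ENNReal.ofReal (2 * d) := by
  refine iSup₂_le fun v hv => ENNReal.ofReal_le_ofReal ?_
  calc ∫ x, (box a b).indicator (fun _ => 1) x * divergence v x
      = ∫ x in box a b, divergence v x := by
        rw [← integral_indicator (measurableSet_box a b)]
        simp only [← Set.indicator_mul_left, one_mul]
    _ ≤ 2 * d := h.setIntegral_divergence_le hv.1 hv.2.2

theorem IsRectangle.isBVSet_box (h : IsRectangle a b) : IsBVSet (box a b) where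
  subset _ hx i := ⟨(h i).1.trans (hx i).1, (hx i).2.trans (h i).2.2⟩
  measurable := (measurableSet_box a b).nullMeasurableSet
  perimeter_lt_top := h.perimeter_box_le.trans_lt ENNReal.ofReal_lt_top

end Rectangles

/-! ### Charges -/

section Indicators

variable {d : ℕ} {A B : Set (E d)}

theorem coeFn_toL1_indicator (hB : IsBVSet B) :
    (BV.toL1 hB.indicator : E d → ℝ) =ᵐ[volume] B.indicator fun _ => (1 : ℝ) :=
  hB.memLp.coeFn_toLp

theorem norm_indicator (hB : IsBVSet B) :
    ‖hB.indicator‖ = volume.real B + (perimeter B).toReal := by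
  have hL1 : ‖BV.toL1 hB.indicator‖ = volume.real B := by
    refine (Lp.norm_toLp _ hB.memLp).trans ?_
    simp [eLpNorm_indicator_const₀ hB.measurable, Measure.real]
  rw [BV.norm_def, hL1, variation_congr (coeFn_toL1_indicator hB), perimeter]

theorem indicator_union_ae_eq {f : E d → ℝ} (hAB : volume (A ∩ B) = 0) :
    (A ∪ B).indicator f =ᵐ[volume] A.indicator f + B.indicator f := by
  filter_upwards [measure_eq_zero_iff_ae_notMem.1 hAB] with x hx
  exact Set.indicator_union_of_notMem_inter hx _

theorem isBVSet_empty (d : ℕ) : IsBVSet (∅ : Set (E d)) where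
  subset := Set.empty_subset _
  measurable := nullMeasurableSet_empty
  perimeter_lt_top := by
    rw [perimeter, Set.indicator_empty]
    exact variation_zero.trans_lt ENNReal.zero_lt_top

theorem IsBVSet.union (hA : IsBVSet A) (hB : IsBVSet B) (hAB : volume (A ∩ B) = 0) :
    IsBVSet (A ∪ B) where
  subset := Set.union_subset hA.subset hB.subset
  measurable := hA.measurable.union hB.measurable
  perimeter_lt_top := by
    rw [perimeter, variation_congr (indicator_union_ae_eq hAB)]
    exact (variation_add_le (memLp_one_iff_integrable.1 hA.memLp)
      (memLp_one_iff_integrable.1 hB.memLp)).trans_lt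
      (ENNReal.add_lt_top.2 ⟨hA.perimeter_lt_top, hB.perimeter_lt_top⟩)

theorem indicator_union (hA : IsBVSet A) (hB : IsBVSet B) (hAB : volume (A ∩ B) = 0) :
    (hA.union hB hAB).indicator = hA.indicator + hB.indicator :=
  BV.toL1_injective <| (MemLp.toLp_congr (hA.union hB hAB).memLp (hA.memLp.add hB.memLp)
    (indicator_union_ae_eq hAB)).trans (MemLp.toLp_add hA.memLp hB.memLp)

theorem setIntegral_unitCube_mul_indicator (hB : IsBVSet B) (g : E d → ℝ) :
    ∫ x in unitCube d, g x * BV.toL1 hB.indicator x = ∫ x in B, g x := by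
  have hae : (fun x => g x * BV.toL1 hB.indicator x) =ᵐ[volume] B.indicator g := by
    filter_upwards [coeFn_toL1_indicator hB] with x hx
    simp only [hx, ← Set.indicator_mul_right, mul_one]
  rw [integral_congr_ae (ae_restrict_of_ae hae),
    integral_indicator₀ (hB.measurable.mono_ac Measure.restrict_le_self.absolutelyContinuous),
    Measure.restrict_restrict_of_subset hB.subset]

end Indicators

section Charges

variable {d : ℕ} {μ : Set (E d) → ℝ}

theorem IsCharge.apply_empty (hμ : IsCharge μ) : μ ∅ = 0 := by
  have h := hμ.additive ∅ ∅ (isBVSet_empty d) (isBVSet_empty d) (by simp)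
  rw [Set.union_empty] at h
  linarith

variable {ι : Type*} {B : ι → Set (E d)}

theorem volume_inter_biUnion_eq_zero (hd : ∀ j k, j ≠ k → volume (B j ∩ B k) = 0) {s : Finset ι}
    {j : ι} (hj : j ∉ s) : volume (B j ∩ ⋃ k ∈ s, B k) = 0 := by
  rw [Set.inter_iUnion₂]
  exact (measure_biUnion_null_iff s.countable_toSet).2 fun k hk => hd j k fun h => hj (h ▸ hk)

theorem isBVSet_biUnion (s : Finset ι) (hB : ∀ j, IsBVSet (B j))
    (hd : ∀ j k, j ≠ k → volume (B j ∩ B k) = 0) : IsBVSet (⋃ j ∈ s, B j) := by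
  classical
  induction s using Finset.induction_on with
  | empty => simpa using isBVSet_empty d
  | insert j s hj ih =>
    rw [Finset.set_biUnion_insert]
    exact (hB j).union ih (volume_inter_biUnion_eq_zero hd hj)

theorem IsCharge.apply_biUnion (hμ : IsCharge μ) (s : Finset ι) (hB : ∀ j, IsBVSet (B j))
    (hd : ∀ j k, j ≠ k → volume (B j ∩ B k) = 0) : μ (⋃ j ∈ s, B j) = ∑ j ∈ s, μ (B j) := by
  classical
  induction s using Finset.induction_on with
  | empty => simp [hμ.apply_empty]
  | insert j s hj ih =>
    rw [Finset.set_biUnion_insert, Finset.sum_insert hj, ← ih]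
    exact hμ.additive _ _ (hB j) (isBVSet_biUnion s hB hd) (volume_inter_biUnion_eq_zero hd hj)

theorem IsCharge.extendsIncrement {f : E d → ℝ} (hμ : IsCharge μ)
    (hf : ∀ a b, IsRectangle a b → μ (box a b) = increment f a b) : ExtendsIncrement f μ := by
  intro m a b hab hnull
  have h := hμ.apply_biUnion Finset.univ (fun j => (hab j).isBVSet_box) hnull
  simpa only [Finset.mem_univ, Set.iUnion_true, hf _ _ (hab _)] using h

theorem tendsto_setIntegral_of_tendsto_measure_symmDiff {X ι : Type*} [MeasurableSpace X]
    {ν : Measure X} {l : Filter ι} {g : X → ℝ} {s : ι → Set X} {t : Set X} (hg : Integrable g ν)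
    (hs : ∀ i, NullMeasurableSet (s i) ν) (ht : NullMeasurableSet t ν)
    (hst : Tendsto (fun i => ν (symmDiff (s i) t)) l (𝓝 0)) :
    Tendsto (fun i => ∫ x in s i, g x ∂ν) l (𝓝 (∫ x in t, g x ∂ν)) := by
  have hsub (i : ι) : ∫ x in s i, g x ∂ν =
      ∫ x in t, g x ∂ν + ∫ x in s i \ t, g x ∂ν - ∫ x in t \ s i, g x ∂ν := by
    rw [← integral_inter_add_sdiff₀ ht hg.integrableOn,
      ← integral_inter_add_sdiff₀ (hs i) hg.integrableOn (s := t), Set.inter_comm t]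
    ring
  have hright := hg.tendsto_setIntegral_nhds_zero (s := fun i => s i \ t) <|
    tendsto_of_tendsto_of_tendsto_of_le_of_le tendsto_const_nhds hst (fun _ => zero_le)
      fun i => measure_mono le_sup_left
  have hleft := hg.tendsto_setIntegral_nhds_zero (s := fun i => t \ s i) <|
    tendsto_of_tendsto_of_tendsto_of_le_of_le tendsto_const_nhds hst (fun _ => zero_le)
      fun i => measure_mono le_sup_right
  simpa only [hsub, add_zero, sub_zero] using (hright.const_add _).sub hleft

theorem tendsto_apply_zero_of_mem_closure {V ι : Type*} [NormedAddCommGroup V] [NormedSpace ℝ V]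
    {l : Filter ι} {T : Set (StrongDual ℝ V)} {α : StrongDual ℝ V} (hα : α ∈ closure T)
    {w : ι → V} {R : ℝ} (hw : ∀ i, ‖w i‖ ≤ R) (hT : ∀ φ ∈ T, Tendsto (fun i => φ (w i)) l (𝓝 0)) :
    Tendsto (fun i => α (w i)) l (𝓝 0) := by
  rw [Metric.tendsto_nhds]
  intro ε hε
  obtain ⟨φ, hφT, hφ⟩ := Metric.mem_closure_iff.1 hα (ε / (2 * (|R| + 1))) (by positivity)
  have happrox (i : ι) : |(α - φ) (w i)| ≤ ε / 2 := by
    calc |(α - φ) (w i)| ≤ ‖α - φ‖ * ‖w i‖ := (α - φ).le_opNorm (w i)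
      _ ≤ ε / (2 * (|R| + 1)) * (|R| + 1) := by
        gcongr
        · exact (dist_eq_norm α φ ▸ hφ).le
        · exact (hw i).trans ((le_abs_self R).trans (lt_add_one _).le)
      _ = ε / 2 := by field_simp
  filter_upwards [Metric.tendsto_nhds.1 (hT φ hφT) (ε / 2) (by positivity)] with i hi
  rw [Real.dist_eq, sub_zero] at hi ⊢
  calc |α (w i)| = |(α - φ) (w i) + φ (w i)| := by simp
    _ ≤ |(α - φ) (w i)| + |φ (w i)| := abs_add_le _ _
    _ < ε := by linarith [happrox i]

theorem tendsto_apply_indicator_of_mem_rangeT (hd : 1 ≤ d) {φ : StrongDual ℝ (BV d)}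
    (hφ : φ ∈ rangeT d) {B : ℕ → Set (E d)} {B' : Set (E d)} (hB : ∀ n, IsBVSet (B n))
    (hB' : IsBVSet B') (hlim : Tendsto (fun n => volume (symmDiff (B n) B')) atTop (𝓝 0)) :
    Tendsto (fun n => φ (hB n).indicator) atTop (𝓝 (φ hB'.indicator)) := by
  obtain ⟨g, hg, hφg⟩ := hφ
  have : Fact (volume (unitCube d) < ∞) := ⟨volume_unitCube_lt_top d⟩
  have hgint : Integrable g (volume.restrict (unitCube d)) :=
    memLp_one_iff_integrable.1 (hg.mono_exponent (by exact_mod_cast hd))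
  have hac := (Measure.restrict_le_self (μ := volume) (s := unitCube d)).absolutelyContinuous
  simp only [hφg, setIntegral_unitCube_mul_indicator]
  simp only [← Measure.restrict_restrict_of_subset (μ := volume) (hB _).subset,
    ← Measure.restrict_restrict_of_subset (μ := volume) hB'.subset]
  exact tendsto_setIntegral_of_tendsto_measure_symmDiff hgint
    (fun n => (hB n).measurable.mono_ac hac) (hB'.measurable.mono_ac hac) <|
    tendsto_of_tendsto_of_tendsto_of_le_of_le tendsto_const_nhds hlim (fun _ => zero_le)
      fun _ => Measure.restrict_le_self _

open Classical in
/-- The set function `B ↦ α(1_B)` on the `BV`-sets, with the junk value `0` on all other sets. -/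
noncomputable def chargeOf (α : StrongDual ℝ (BV d)) (B : Set (E d)) : ℝ :=
  if hB : IsBVSet B then α hB.indicator else 0

theorem chargeOf_apply (α : StrongDual ℝ (BV d)) {B : Set (E d)} (hB : IsBVSet B) :
    chargeOf α B = α hB.indicator := dif_pos hB

theorem norm_indicator_le_of_perimeter_le {B : Set (E d)} (hB : IsBVSet B) {P : ℝ≥0∞}
    (hP : P ≠ ∞) (hBP : perimeter B ≤ P) :
    ‖hB.indicator‖ ≤ volume.real (unitCube d) + P.toReal := by
  rw [norm_indicator hB]
  gcongr
  exacts [(volume_unitCube_lt_top d).ne, hB.subset]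

theorem isCharge_chargeOf (hd : 1 ≤ d) {α : StrongDual ℝ (BV d)} (hα : α ∈ SCH d) :
    IsCharge (chargeOf α) where
  additive B₁ B₂ h₁ h₂ h := by
    rw [chargeOf_apply α (h₁.union h₂ h), indicator_union h₁ h₂ h, map_add, chargeOf_apply α h₁,
      chargeOf_apply α h₂]
  continuous B B' hB hB' hP hlim := by
    simp only [chargeOf_apply α (hB _), chargeOf_apply α hB']
    have hbound (n : ℕ) := (norm_sub_le (hB n).indicator hB'.indicator).trans <| add_le_add_left
      (norm_indicator_le_of_perimeter_le (hB n) hP.ne (le_iSup (fun n => perimeter (B n)) n)) _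
    rw [← tendsto_sub_nhds_zero_iff]
    simp only [← map_sub]
    refine tendsto_apply_zero_of_mem_closure hα hbound fun φ hφ => ?_
    simp only [map_sub, tendsto_sub_nhds_zero_iff]
    exact tendsto_apply_indicator_of_mem_rangeT hd hφ hB hB' hlim

theorem isStrongCharge_chargeOf (hd : 1 ≤ d) {α : StrongDual ℝ (BV d)} (hα : α ∈ SCH d) :
    IsStrongCharge (chargeOf α) :=
  ⟨isCharge_chargeOf hd hα, α, hα, fun _ hB => chargeOf_apply α hB⟩

end Charges

section GridRectangles

variable {d : ℕ} {a b : Fin d → ℝ}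

theorem tendsto_volume_symmDiff_box {ι : Type*} {l : Filter ι} {a' b' : ι → Fin d → ℝ}
    (hsub : ∀ n, a ≤ a' n ∧ a' n ≤ b' n ∧ b' n ≤ b) (ha : Tendsto a' l (𝓝 a))
    (hb : Tendsto b' l (𝓝 b)) :
    Tendsto (fun n => volume (symmDiff (box (a' n) (b' n)) (box a b))) l (𝓝 0) := by
  have hreal (n : ι) : volume.real (symmDiff (box (a' n) (b' n)) (box a b)) =
      ∏ i, (b i - a i) - ∏ i, (b' n i - a' n i) := by
    obtain ⟨haa, hab, hbb⟩ := hsub n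
    have hss : box (a' n) (b' n) ⊆ box a b := fun x hx i =>
      ⟨(haa i).trans (hx i).1, (hx i).2.trans (hbb i)⟩
    rw [symmDiff_of_le hss, measureReal_sdiff hss (measurableSet_box _ _)
      (isCompact_box _ _).measure_ne_top, volume_real_box fun i => hab i,
      volume_real_box fun i => (haa i).trans ((hab i).trans (hbb i))]
  have hfin (n : ι) : volume (symmDiff (box (a' n) (b' n)) (box a b)) ≠ ∞ :=
    ((measure_mono symmDiff_le_sup).trans_lt (measure_union_lt_top
      (isCompact_box _ _).measure_lt_top (isCompact_box _ _).measure_lt_top)).ne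
  have hprod : Tendsto (fun n => ∏ i, (b' n i - a' n i)) l (𝓝 (∏ i, (b i - a i))) :=
    tendsto_finsetProd _ fun i _ => (tendsto_pi_nhds.1 hb i).sub (tendsto_pi_nhds.1 ha i)
  rw [← ENNReal.tendsto_toReal_iff hfin ENNReal.zero_ne_top, ENNReal.toReal_zero]
  refine Tendsto.congr (fun n => (hreal n).symm) ?_
  simpa only [sub_self] using hprod.const_sub (∏ i, (b i - a i))

theorem IsCharge.apply_box_eq_of_tendsto {μ : Set (E d) → ℝ} (hμ : IsCharge μ) {f : E d → ℝ}
    (hf : Continuous f) (hab : IsRectangle a b) {a' b' : ℕ → Fin d → ℝ}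
    (hsub : ∀ n, a ≤ a' n ∧ (∀ i, a' n i < b' n i) ∧ b' n ≤ b) (ha : Tendsto a' atTop (𝓝 a))
    (hb : Tendsto b' atTop (𝓝 b))
    (hμf : ∀ n, μ (box (a' n) (b' n)) = increment f (a' n) (b' n)) :
    μ (box a b) = increment f a b := by
  have hrect (n : ℕ) : IsRectangle (a' n) (b' n) := fun i =>
    ⟨(hab i).1.trans ((hsub n).1 i), (hsub n).2.1 i, ((hsub n).2.2 i).trans (hab i).2.2⟩
  have hper : ⨆ n, perimeter (box (a' n) (b' n)) < ∞ :=
    (iSup_le fun n => (hrect n).perimeter_box_le).trans_lt ENNReal.ofReal_lt_top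
  have hvol : Tendsto (fun n => volume (symmDiff (box (a' n) (b' n)) (box a b))) atTop (𝓝 0) :=
    tendsto_volume_symmDiff_box
      (fun n => ⟨(hsub n).1, fun i => ((hsub n).2.1 i).le, (hsub n).2.2⟩) ha hb
  have hμlim : Tendsto (fun n => μ (box (a' n) (b' n))) atTop (𝓝 (μ (box a b))) :=
    hμ.continuous _ _ (fun n => (hrect n).isBVSet_box) hab.isBVSet_box hper hvol
  have hflim : Tendsto (fun n => increment f (a' n) (b' n)) atTop (𝓝 (increment f a b)) :=
    tendsto_increment hf ha hb
  exact tendsto_nhds_unique hμlim (hflim.congr fun n => (hμf n).symm)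

theorem le_gridPoint_ceil (n : ℕ) (x : Fin d → ℝ) : x ≤ gridPoint n fun i => ⌈2 ^ n * x i⌉ :=
  fun i => (le_div_iff₀' (by positivity)).2 (Int.le_ceil _)

theorem gridPoint_floor_le (n : ℕ) (x : Fin d → ℝ) : (gridPoint n fun i => ⌊2 ^ n * x i⌋) ≤ x :=
  fun i => (div_le_iff₀' (by positivity)).2 (Int.floor_le _)

theorem tendsto_gridPoint {k : ℕ → Fin d → ℤ} {x : Fin d → ℝ}
    (hk : ∀ n i, |(k n i : ℝ) - 2 ^ n * x i| ≤ 1) :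
    Tendsto (fun n => gridPoint n (k n)) atTop (𝓝 x) := by
  refine tendsto_pi_nhds.2 fun i => tendsto_iff_dist_tendsto_zero.2 ?_
  refine squeeze_zero (fun _ => dist_nonneg) (fun n => ?_)
    (tendsto_pow_atTop_nhds_zero_of_lt_one (r := 1 / 2) (by norm_num) (by norm_num))
  calc dist (gridPoint n (k n) i) (x i) = |(k n i : ℝ) - 2 ^ n * x i| / 2 ^ n := by
        have hpos : (0 : ℝ) < 2 ^ n := by positivity
        rw [Real.dist_eq, gridPoint, div_sub' hpos.ne', abs_div, abs_of_pos hpos]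
    _ ≤ 1 / 2 ^ n := by gcongr; exact hk n i
    _ = (1 / 2) ^ n := by rw [one_div_pow]

theorem IsCharge.apply_box_eq_of_gridPoint {μ : Set (E d) → ℝ} (hμ : IsCharge μ) {f : E d → ℝ}
    (hf : Continuous f)
    (hgrid : ∀ n k l, IsRectangle (gridPoint n k) (gridPoint n l) →
      μ (box (gridPoint n k) (gridPoint n l)) = increment f (gridPoint n k) (gridPoint n l))
    (hab : IsRectangle a b) : μ (box a b) = increment f a b := by
  have ha : Tendsto (fun n => gridPoint n fun i => ⌈2 ^ n * a i⌉) atTop (𝓝 a) :=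
    tendsto_gridPoint fun n i => by
      have := Int.ceil_lt_add_one (2 ^ n * a i)
      rw [abs_of_nonneg (sub_nonneg.2 (Int.le_ceil _))]
      linarith
  have hb : Tendsto (fun n => gridPoint n fun i => ⌊2 ^ n * b i⌋) atTop (𝓝 b) :=
    tendsto_gridPoint fun n i => by
      have := Int.sub_one_lt_floor (2 ^ n * b i)
      rw [abs_sub_comm, abs_of_nonneg (sub_nonneg.2 (Int.floor_le _))]
      linarith
  have hlt : ∀ᶠ n in atTop, ∀ i,
      gridPoint n (fun i => ⌈2 ^ n * a i⌉) i < gridPoint n (fun i => ⌊2 ^ n * b i⌋) i :=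
    eventually_all.2 fun i =>
      (tendsto_pi_nhds.1 ha i).eventually_lt (tendsto_pi_nhds.1 hb i) (hab i).2.1
  obtain ⟨N, hN⟩ := eventually_atTop.1 hlt
  have hshift := tendsto_add_atTop_nat N
  refine hμ.apply_box_eq_of_tendsto hf hab
    (fun n => ⟨le_gridPoint_ceil _ _, hN _ le_add_self, gridPoint_floor_le _ _⟩)
    (ha.comp hshift) (hb.comp hshift) fun n => hgrid _ _ _ fun i => ⟨?_, hN _ le_add_self i, ?_⟩
  · exact (hab i).1.trans (le_gridPoint_ceil _ _ i)
  · exact (gridPoint_floor_le _ _ i).trans (hab i).2.2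

end GridRectangles

/-! ### Strong chargeability -/

section DensityFunctional

variable {d : ℕ} {g h : E d → ℝ}

/-- The functional `u ↦ ∫ g u` on `BV([0,1]^d)` given by a bounded density `g`. -/
noncomputable def densityFunctional (g : E d → ℝ) (hg : MemLp g ∞ volume) : StrongDual ℝ (BV d) :=
  (ContinuousLinearMap.lpPairing volume ∞ 1 (ContinuousLinearMap.mul ℝ ℝ) (hg.toLp g)).comp
    (BV.toL1.mkContinuous 1 fun u => by
      rw [one_mul, BV.norm_def]
      exact le_add_of_nonneg_right ENNReal.toReal_nonneg)

theorem densityFunctional_apply (hg : MemLp g ∞ volume) (u : BV d) :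
    densityFunctional g hg u = ∫ x, g x * BV.toL1 u x := by
  refine (ContinuousLinearMap.lpPairing_eq_integral _ _ _).trans (integral_congr_ae ?_)
  filter_upwards [hg.coeFn_toLp] with x hx
  rw [hx]
  rfl

theorem densityFunctional_apply_eq_setIntegral (hg : MemLp g ∞ volume) (u : BV d) :
    densityFunctional g hg u = ∫ x in unitCube d, g x * BV.toL1 u x := by
  have hu : ∀ᵐ x, x ∉ unitCube d → BV.toL1 u x = 0 := (show bvSubmodule d from u).2.1
  rw [densityFunctional_apply, setIntegral_eq_integral_of_ae_compl_eq_zero]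
  filter_upwards [hu] with x hx hxc
  rw [hx hxc, mul_zero]

theorem densityFunctional_apply_indicator (hg : MemLp g ∞ volume) {B : Set (E d)}
    (hB : IsBVSet B) : densityFunctional g hg hB.indicator = ∫ x in B, g x := by
  rw [densityFunctional_apply_eq_setIntegral, setIntegral_unitCube_mul_indicator]

theorem densityFunctional_mem_rangeT (hg : MemLp g ∞ volume) : densityFunctional g hg ∈ rangeT d :=
  have : Fact (volume (unitCube d) < ∞) := ⟨volume_unitCube_lt_top d⟩
  ⟨g, (hg.restrict _).mono_exponent le_top, densityFunctional_apply_eq_setIntegral hg⟩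

theorem norm_densityFunctional_sub_le {n : ℕ} {S : ℝ} (hg : MemLp g ∞ volume)
    (hh : MemLp h ∞ volume) (hgS : ∀ x, |g x| ≤ S) (hgh : ∀ x, dyadicAverage n g x = h x) :
    ‖densityFunctional g hg - densityFunctional h hh‖ ≤ 2 ^ d * d * (S / 2 ^ n) := by
  have hS : 0 ≤ S := (abs_nonneg _).trans (hgS 0)
  refine ContinuousLinearMap.opNorm_le_bound _ (by positivity) fun u => ?_
  have hu := L1.integrable_coeFn (BV.toL1 u)
  have hgu : Integrable (fun x => g x * BV.toL1 u x) := hu.mul_of_top_right hg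
  have hhu : Integrable (fun x => h x * BV.toL1 u x) := hu.mul_of_top_right hh
  have hdiff : (densityFunctional g hg - densityFunctional h hh) u =
      ∫ x, BV.toL1 u x * (g x - dyadicAverage n g x) := by
    rw [sub_apply, densityFunctional_apply, densityFunctional_apply,
      ← integral_sub hgu hhu]
    simp only [hgh, mul_comm (BV.toL1 u _), sub_mul]
  rw [hdiff]
  calc ‖∫ x, BV.toL1 u x * (g x - dyadicAverage n g x)‖
      ≤ 2 ^ d * d * (S / 2 ^ n) * (variation (BV.toL1 u)).toReal :=
        abs_integral_mul_sub_dyadicAverage_le hu (BV.variation_lt_top u).ne hg.1 hgS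
    _ ≤ 2 ^ d * d * (S / 2 ^ n) * ‖u‖ := by
        gcongr
        rw [BV.norm_def]
        exact le_add_of_nonneg_left (norm_nonneg _)

end DensityFunctional

section Summable

variable {d : ℕ} {f : E d → ℝ} {S : ℕ → ℝ}

theorem memLp_top_dyadicDensity {n : ℕ} {s : ℝ}
    (hs : ∀ k, |increment f (gridPoint n k) (gridPoint n (k + 1))| ≤ s) :
    MemLp (dyadicDensity f n) ∞ volume :=
  memLp_top_of_bound (measurable_dyadicDensity f n).aestronglyMeasurable _
    (Eventually.of_forall (abs_dyadicDensity_le hs))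

theorem cauchySeq_densityFunctional_dyadicDensity
    (hS : ∀ n k, |increment f (gridPoint n k) (gridPoint n (k + 1))| ≤ S n)
    (hsum : Summable fun n => (2 ^ n) ^ d * S n / 2 ^ n) :
    CauchySeq fun n => densityFunctional (dyadicDensity f n) (memLp_top_dyadicDensity (hS n)) := by
  have hsucc : Summable fun n => (2 ^ (n + 1)) ^ d * S (n + 1) / 2 ^ (n + 1) :=
    (summable_nat_add_iff 1).2 hsum
  refine cauchySeq_of_dist_le_of_summable
    (fun n => 2 ^ d * d * 2 * ((2 ^ (n + 1)) ^ d * S (n + 1) / 2 ^ (n + 1))) (fun n => ?_)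
    (hsucc.mul_left _)
  rw [dist_comm, dist_eq_norm]
  refine (norm_densityFunctional_sub_le _ _ (abs_dyadicDensity_le (hS (n + 1)))
    (dyadicAverage_dyadicDensity_succ f n)).trans_eq ?_
  field_simp
  ring

theorem densityFunctional_dyadicDensity_apply_box {N m : ℕ} (hNm : N ≤ m) {s : ℝ}
    (hs : ∀ k, |increment f (gridPoint m k) (gridPoint m (k + 1))| ≤ s) {k l : Fin d → ℤ}
    (hkl : IsRectangle (gridPoint N k) (gridPoint N l)) :
    densityFunctional (dyadicDensity f m) (memLp_top_dyadicDensity hs) hkl.isBVSet_box.indicator =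
      increment f (gridPoint N k) (gridPoint N l) := by
  obtain ⟨j, rfl⟩ := Nat.exists_eq_add_of_le hNm
  have hlt (i : Fin d) : k i < l i := by
    have := (hkl i).2.1
    rwa [gridPoint, gridPoint, div_lt_div_iff_of_pos_right (by positivity), Int.cast_lt] at this
  rw [densityFunctional_apply_indicator, ← gridPoint_add N j k, ← gridPoint_add N j l,
    setIntegral_box_dyadicDensity]
  exact fun i => mul_lt_mul_of_pos_left (hlt i) (by simp)

theorem exists_isStrongChargeOf_of_continuous (hd : 1 ≤ d) (hf : Continuous f)
    (hS : ∀ n k, |increment f (gridPoint n k) (gridPoint n (k + 1))| ≤ S n)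
    (hsum : Summable fun n => (2 ^ n) ^ d * S n / 2 ^ n) : ∃ μ, IsStrongChargeOf f μ := by
  obtain ⟨α, hα⟩ :=
    cauchySeq_tendsto_of_complete (cauchySeq_densityFunctional_dyadicDensity hS hsum)
  have hαSCH : α ∈ SCH d :=
    mem_closure_of_tendsto hα (Eventually.of_forall fun n => densityFunctional_mem_rangeT _)
  have hcharge := isCharge_chargeOf hd hαSCH
  refine ⟨chargeOf α, isStrongCharge_chargeOf hd hαSCH, hcharge.extendsIncrement fun a b hab =>
    hcharge.apply_box_eq_of_gridPoint hf (fun n k l hkl => ?_) hab⟩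
  rw [chargeOf_apply α hkl.isBVSet_box]
  have happly := ((ContinuousLinearMap.apply ℝ ℝ hkl.isBVSet_box.indicator).continuous.tendsto
    α).comp hα
  refine tendsto_nhds_unique happly (tendsto_const_nhds.congr' ?_)
  filter_upwards [eventually_ge_atTop n] with m hm
  exact (densityFunctional_dyadicDensity_apply_box hm (hS m) hkl).symm

end Summable

section CubeRetraction

variable {d : ℕ} {f : E d → ℝ} {a b : Fin d → ℝ}

/-- The nearest point of `[0,1]`. -/
noncomputable def clamp (t : ℝ) : ℝ := Set.projIcc 0 1 zero_le_one t

/-- The retraction of `ℝ^d` onto the unit cube that clamps every coordinate. Composition with it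
extends functions on the cube to `ℝ^d` without creating increments outside the cube. -/
noncomputable def cubeRetraction (x : E d) : E d := WithLp.toLp 2 fun i => clamp (x i)

theorem clamp_of_mem {t : ℝ} (ht : t ∈ Set.Icc 0 1) : clamp t = t := by
  rw [clamp, Set.projIcc_of_mem _ ht]

theorem continuous_comp_cubeRetraction (hf : ContinuousOn f (unitCube d)) :
    Continuous fun x => f (cubeRetraction x) := by
  refine hf.comp_continuous ((PiLp.continuous_toLp 2 fun _ : Fin d => ℝ).comp <|
    continuous_pi fun i => ?_) fun x i => (Set.projIcc 0 1 zero_le_one (x i)).2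
  exact continuous_subtype_val.comp (continuous_projIcc.comp (PiLp.continuous_apply 2 _ i))

theorem increment_comp_cubeRetraction (f : E d → ℝ) (a b : Fin d → ℝ) :
    increment (fun x => f (cubeRetraction x)) a b = increment f (clamp ∘ a) (clamp ∘ b) :=
  increment_comp f clamp a b

theorem IsRectangle.increment_comp_cubeRetraction (h : IsRectangle a b) (f : E d → ℝ) :
    increment (fun x => f (cubeRetraction x)) a b = increment f a b := by
  have ha : clamp ∘ a = a := funext fun i =>
    clamp_of_mem ⟨(h i).1, (h i).2.1.le.trans (h i).2.2⟩
  have hb : clamp ∘ b = b := funext fun i =>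
    clamp_of_mem ⟨(h i).1.trans (h i).2.1.le, (h i).2.2⟩
  rw [StrongCharge.increment_comp_cubeRetraction, ha, hb]

theorem dyadicLower_eq_gridPoint (n : ℕ) (k : Fin d → Fin (2 ^ n)) :
    dyadicLower n k = gridPoint n fun i => ((k i : ℕ) : ℤ) :=
  rfl

theorem dyadicUpper_eq_gridPoint (n : ℕ) (k : Fin d → Fin (2 ^ n)) :
    dyadicUpper n k = gridPoint n ((fun i => ((k i : ℕ) : ℤ)) + 1) := by
  funext i
  simp [dyadicUpper, gridPoint]

theorem isRectangle_dyadic (n : ℕ) (k : Fin d → Fin (2 ^ n)) :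
    IsRectangle (dyadicLower n k) (dyadicUpper n k) := fun i => by
  have hk : ((k i : ℕ) : ℝ) + 1 ≤ 2 ^ n := by exact_mod_cast (k i).2
  refine ⟨div_nonneg (Nat.cast_nonneg _) (by positivity), ?_, (div_le_one (by positivity)).2 hk⟩
  rw [dyadicLower, dyadicUpper]
  gcongr
  exact lt_add_one _

theorem clamp_gridPoint_eq_add_one {n : ℕ} {k : Fin d → ℤ} {i : Fin d}
    (hk : k i < 0 ∨ 2 ^ n ≤ k i) : clamp (gridPoint n k i) = clamp (gridPoint n (k + 1) i) := by
  have hle : gridPoint n k i ≤ gridPoint n (k + 1) i := by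
    simp only [gridPoint, Pi.add_apply, Pi.one_apply]
    gcongr
    simp
  rcases hk with hk | hk
  · have hneg : gridPoint n (k + 1) i ≤ 0 :=
      div_nonpos_of_nonpos_of_nonneg (Int.cast_nonpos.2 hk) (by positivity)
    rw [clamp, clamp, Set.projIcc_of_le_left _ hneg, Set.projIcc_of_le_left _ (hle.trans hneg)]
  · have hone : 1 ≤ gridPoint n k i := (one_le_div (by positivity)).2 (by exact_mod_cast hk)
    rw [clamp, clamp, Set.projIcc_of_right_le _ hone, Set.projIcc_of_right_le _ (hone.trans hle)]

theorem abs_increment_comp_cubeRetraction_gridPoint_le {n : ℕ} {s : ℝ}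
    (hs : ∀ k, |increment f (dyadicLower n k) (dyadicUpper n k)| ≤ s) (k : Fin d → ℤ) :
    |increment (fun x => f (cubeRetraction x)) (gridPoint n k) (gridPoint n (k + 1))| ≤ s := by
  by_cases hk : ∀ i, 0 ≤ k i ∧ k i < 2 ^ n
  · lift k to Fin d → ℕ using fun i => (hk i).1
    have hlt (i : Fin d) : (k i : ℤ) < 2 ^ n := (hk i).2
    let c (i : Fin d) : Fin (2 ^ n) := ⟨k i, by exact_mod_cast hlt i⟩
    have hlower : dyadicLower n c = gridPoint n fun i => (k i : ℤ) := dyadicLower_eq_gridPoint n c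
    have hupper : dyadicUpper n c = gridPoint n ((fun i => (k i : ℤ)) + 1) :=
      dyadicUpper_eq_gridPoint n c
    rw [← hlower, ← hupper, (isRectangle_dyadic n c).increment_comp_cubeRetraction]
    exact hs c
  · push Not at hk
    obtain ⟨i, hi⟩ := hk
    have hout : k i < 0 ∨ 2 ^ n ≤ k i := (lt_or_ge (k i) 0).imp_right hi
    rw [increment_comp_cubeRetraction,
      increment_eq_zero_of_eq (i := i) (clamp_gridPoint_eq_add_one hout), abs_zero]
    exact (abs_nonneg _).trans (hs fun _ => 0)

theorem exists_isStrongChargeOf_of_summable {S : ℕ → ℝ} (hd : 1 ≤ d)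
    (hf : ContinuousOn f (unitCube d))
    (hS : ∀ n k, |increment f (dyadicLower n k) (dyadicUpper n k)| ≤ S n)
    (hsum : Summable fun n => (2 ^ n) ^ d * S n / 2 ^ n) : ∃ μ, IsStrongChargeOf f μ := by
  obtain ⟨μ, hμ, hext⟩ := exists_isStrongChargeOf_of_continuous hd
    (continuous_comp_cubeRetraction hf)
    (fun n => abs_increment_comp_cubeRetraction_gridPoint_le (hS n)) hsum
  refine ⟨μ, hμ, fun m a b hab hdisj => (hext m a b hab hdisj).trans ?_⟩
  exact Finset.sum_congr rfl fun j _ => (hab j).increment_comp_cubeRetraction f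

end CubeRetraction

section Holder

variable {d : ℕ} {γ : ℝ}

theorem volume_real_dyadicCube (n : ℕ) (k : Fin d → Fin (2 ^ n)) :
    volume.real (dyadicCube n k) = (1 / 2 ^ n) ^ d := by
  rw [dyadicCube, volume_real_box fun i => (isRectangle_dyadic n k i).2.1.le]
  simp [dyadicLower, dyadicUpper, ← sub_div]

theorem two_pow_pow_mul_rpow_div (d : ℕ) (γ : ℝ) (n : ℕ) :
    ((2 : ℝ) ^ n) ^ d * ((1 / 2 ^ n) ^ d) ^ γ / 2 ^ n = ((2 : ℝ) ^ (d * (1 - γ) - 1)) ^ n := by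
  have htwo : (0 : ℝ) ≤ 2 := zero_le_two
  rw [one_div, inv_pow, ← pow_mul, ← Real.rpow_natCast 2 (n * d), ← Real.rpow_natCast 2 n,
    ← Real.rpow_neg htwo, ← Real.rpow_mul htwo, ← Real.rpow_add two_pos, ← Real.rpow_sub two_pos,
    ← Real.rpow_mul_natCast htwo]
  push_cast
  ring_nf

theorem summable_two_pow_pow_mul_rpow (hd : 1 ≤ d) (hγ : ((d : ℝ) - 1) / d < γ) (C : ℝ) :
    Summable fun n => ((2 : ℝ) ^ n) ^ d * (C * ((1 / 2 ^ n) ^ d) ^ γ) / 2 ^ n := by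
  have hexp : (d : ℝ) * (1 - γ) - 1 < 0 := by
    rw [div_lt_iff₀' (Nat.cast_pos.2 hd)] at hγ
    linarith
  have hgeom := (summable_geometric_of_lt_one (by positivity)
    (Real.rpow_lt_one_of_one_lt_of_neg one_lt_two hexp)).mul_left C
  refine hgeom.congr fun n => ?_
  rw [← two_pow_pow_mul_rpow_div, mul_left_comm (_ ^ d), mul_div_assoc C]

theorem ExtendsIncrement.apply_dyadicCube {f : E d → ℝ} {μ : Set (E d) → ℝ}
    (h : ExtendsIncrement f μ) (n : ℕ) (k : Fin d → Fin (2 ^ n)) :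
    μ (dyadicCube n k) = increment f (dyadicLower n k) (dyadicUpper n k) := by
  simpa only [dyadicCube, Set.iUnion_const, Finset.sum_const, Finset.card_univ, Fintype.card_fin,
    one_smul]
    using h 1 (fun _ => dyadicLower n k) (fun _ => dyadicUpper n k)
      (fun _ => isRectangle_dyadic n k) fun i j hij => (hij (Subsingleton.elim i j)).elim

end Holder

end StrongCharge

theorem mainTheorem10_general (d : ℕ) (hd : 1 ≤ d) (γ : ℝ) (hγ : ((d : ℝ) - 1) / d < γ)
    (f : StrongCharge.E d → ℝ) (hf : ContinuousOn f (StrongCharge.unitCube d)) (C : ℝ) (hC : 0 ≤ C)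
    (hinc : ∀ (n : ℕ) (k : Fin d → Fin (2 ^ n)),
      |StrongCharge.increment f (StrongCharge.dyadicLower n k) (StrongCharge.dyadicUpper n k)|
        ≤ C * (MeasureTheory.volume.real (StrongCharge.dyadicCube n k)) ^ γ) :
    StrongCharge.IsHolderStronglyChargeable γ f := by
  obtain ⟨μ, hμ⟩ := StrongCharge.exists_isStrongChargeOf_of_summable hd hf
    (fun n k => StrongCharge.volume_real_dyadicCube n k ▸ hinc n k)
    (StrongCharge.summable_two_pow_pow_mul_rpow hd hγ C)
  refine ⟨μ, hμ, C, hC, fun n k => ?_⟩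
  rw [hμ.2.apply_dyadicCube]
  exact hinc n k

theorem mainTheorem10 (d : ℕ) (hd : 1 ≤ d) (γ : ℝ) (hγ : ((d : ℝ) - 1) / d < γ) (hγ1 : γ < 1)
    (f : StrongCharge.E d → ℝ) (hf : StrongCharge.MemC0 f) (C : ℝ) (hC : 0 ≤ C)
    (hinc : ∀ (n : ℕ) (k : Fin d → Fin (2 ^ n)),
      |StrongCharge.increment f (StrongCharge.dyadicLower n k) (StrongCharge.dyadicUpper n k)|
        ≤ C * (MeasureTheory.volume.real (StrongCharge.dyadicCube n k)) ^ γ) :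
    StrongCharge.IsHolderStronglyChargeable γ f :=
  mainTheorem10_general d hd γ hγ f hf.1 C hC hinc
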